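/- Let $\kappa>0$. On $\mathbb C^4=\mathbb H^2$ with coordinates $(Z,W)$, $Z=(Z_1,Z_2)$, $W=(W_1,W_2)$, take the flat metric $|dZ|^2+|dW|^2$, the forms $\omega_R=\frac i2\sum_a(dZ_a\wedge d\bar Z_a+dW_a\wedge d\bar W_a)$, $\omega_C=\sum_a dW_a\wedge dZ_a$, and the $U(1)$ action $(Z,W)\mapsto(e^{it}Z,e^{-it}W)$ with generator $\xi=(iZ,-iW)$. Let $\mu=(\mu_R,\mu_C)$, where $\mu_R=|Z|^2-|W|^2-2\sqrt\kappa$ and $\mu_C=Z_1W_1+Z_2W_2$. (1) The action preserves the metric, $\omega_R$ and $\omega_C$, and $\mu$ is (up to constant normalisations) its hyperkähler moment map: $d\mu_R=-2\,\iota_\xi\omega_R$, $d\mu_C=i\,\iota_\xi\omega_C$. The differential $d\mu$ is surjective at every point of $\mu^{-1}(0)$, so $\mu^{-1}(0)$ is a smooth real 5-manifold; $U(1)$ preserves it and acts freely on it. The form $\eta=\langle\xi,\cdot\rangle/\langle\xi,\xi\rangle$ on $\mu^{-1}(0)$ is $U(1)$-invariant with $\eta(\xi)=1$, i.e. it is the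 connection form whose horizontal spaces are the orthogonal complements of the orbits; the quotient metric of half the flat metric (half the flat inner product of horizontal parts) is also $U(1)$-invariant. (2) For $z=(z_1,z_2)\in\mathbb C^2\setminus\{0\}$ put $s=|z_1|^2+|z_2|^2$, $F=\sqrt{1+\kappa/s^2}$, $f=F+\sqrt\kappa/s$, and for $\psi\in\mathbb R$ let $\Phi(\psi,z)=(Z,W)$ with $Z=z\,e^{i\psi}f^{1/2}$, $W=(-z_2,z_1)e^{-i\psi}f^{-1/2}$. Then $\Phi$ is a smooth immersion with image $\{(Z,W)\in\mu^{-1}(0):W\ne0\}$, the range of $d\Phi$ is the tangent space $\ker d\mu$, one has $\Phi(\psi+t,z)=e^{it}\cdot\Phi(\psi,z)$, and $\Phi(\psi,z)=\Phi(\psi',z')$ if and only if $(z',e^{i\psi'})=\pm(z,e^{i\psi})$. (3) The pull-back by $\Phi$ of half the flat metric is $$\tfrac12\big(|dZ|^2+|dW|^2\big)=g+sF\big(d\psi+i(A-\bar A)\big)^2,$$ $$g=F(|dz_1|^2+|dz_2|^2)+\tfrac1s(F^{-1}-F)|\bar z_1dz_1+\bar z_2dz_2|^2,\qquad A=\frac{\sqrt\kappa}{2s^2F}(z_1d\bar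 z_1+z_2d\bar z_2),$$ and $g$ equals the Eguchi–Hanson metric $$g_{EH}=\tfrac1s\big(F|z_1dz_2-z_2dz_1|^2+F^{-1}|\bar z_1dz_1+\bar z_2dz_2|^2\big).$$ (4) The map $z\mapsto[\Phi(\psi,z)]$ (independent of $\psi$) from $\mathbb C^2\setminus\{0\}$ to the hyperkähler quotient $\mu^{-1}(0)/U(1)$ is continuous and open, its fibres are the pairs $\{z,-z\}$, and its image is the dense open set of orbits with $W\neq0$; the quotient metric induced by half the flat metric is $g_{EH}$ in these coordinates. Moreover $\Phi^*\eta=d\psi+i(A-\bar A)$, so $A-\bar A$ is the connection of the circle bundle $\mu^{-1}(0)\to\mu^{-1}(0)/U(1)$. (5) The curvature $d(A-\bar A)$ is anti-self-dual with respect to $g_{EH}$ and the complex orientation of $\mathbb C^2$, and it is square integrable with respect to $g_{EH}$ on $\mathbb C^2\setminus\{0\}$. -/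

import Mathlib

open scoped ContDiff ComplexConjugate

noncomputable section

namespace EguchiHanson

/-- Coordinates `z = (z₁, z₂)`; as a real vector space this is also the tangent space at a point. -/
abbrev C2 := ℂ × ℂ

/-- `ℂ⁴ = ℍ²` with coordinates `(Z, W)`, `Z = (Z₁, Z₂)`, `W = (W₁, W₂)`; also its tangent space. -/
abbrev C4 := C2 × C2

/-! ### The flat hyperkähler space and the circle action -/

/-- The flat metric `|dZ₁|² + |dZ₂|² + |dW₁|² + |dW₂|²`, as a symmetric bilinear form. -/
def flatMetric (X Y : C4) : ℝ :=
  (X.1.1 * conj Y.1.1 + X.1.2 * conj Y.1.2 + X.2.1 * conj Y.2.1 + X.2.2 * conj Y.2.2).re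

/-- `ω_R = (i/2) ∑ (dZₐ ∧ dZ̄ₐ + dWₐ ∧ dW̄ₐ)`; note `(i/2) dx ∧ dx̄ (X, Y) = Im (X̄ Y)`. -/
def omegaR (X Y : C4) : ℝ :=
  (conj X.1.1 * Y.1.1 + conj X.1.2 * Y.1.2 + conj X.2.1 * Y.2.1 + conj X.2.2 * Y.2.2).im

/-- `ω_C = dW₁ ∧ dZ₁ + dW₂ ∧ dZ₂`. -/
def omegaC (X Y : C4) : ℂ :=
  (X.2.1 * Y.1.1 - Y.2.1 * X.1.1) + (X.2.2 * Y.1.2 - Y.2.2 * X.1.2)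

/-- The action `(Z, W) ↦ (u Z, u⁻¹ W)` of `u ∈ U(1)`. It is real linear, so it also
describes the action on tangent vectors. -/
def circleAct (u : Circle) (p : C4) : C4 :=
  ((u : ℂ) • p.1, ((u⁻¹ : Circle) : ℂ) • p.2)

/-- The vector field `ξ = (iZ, -iW)` generating the action. -/
def generator (p : C4) : C4 := (Complex.I • p.1, -Complex.I • p.2)

/-- `μ_R = |Z|² - |W|² - 2√κ`. -/
def muR (κ : ℝ) (p : C4) : ℝ :=
  (‖p.1.1‖ ^ 2 + ‖p.1.2‖ ^ 2) - (‖p.2.1‖ ^ 2 + ‖p.2.2‖ ^ 2) - 2 * √κ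

/-- `μ_C = Z₁ W₁ + Z₂ W₂`. -/
def muC (p : C4) : ℂ := p.1.1 * p.2.1 + p.1.2 * p.2.2

/-- The hyperkähler moment map `μ = (μ_R, μ_C)`. -/
def moment (κ : ℝ) (p : C4) : ℝ × ℂ := (muR κ p, muC p)

/-- The level set `μ⁻¹(0)`. -/
def levelSet (κ : ℝ) : Set C4 := {p | moment κ p = 0}

/-- Two points of the level set are equivalent when they lie on the same `U(1)`-orbit. -/
def orbitSetoid (κ : ℝ) : Setoid (levelSet κ) where
  r p q := ∃ u : Circle, circleAct u p.1 = q.1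
  iseqv := by
    refine ⟨fun p => ⟨1, ?_⟩, ?_, ?_⟩
    · simp [circleAct]
    · rintro p q ⟨u, hu⟩
      refine ⟨u⁻¹, ?_⟩
      rw [← hu]
      simp [circleAct, smul_smul]
    · rintro p q r ⟨u, hu⟩ ⟨v, hv⟩
      refine ⟨v * u, ?_⟩
      rw [← hv, ← hu]
      simp [circleAct, smul_smul, mul_comm]

/-- The hyperkähler quotient `μ⁻¹(0) / U(1)`, with the quotient topology. -/
abbrev HKQuotient (κ : ℝ) := Quotient (orbitSetoid κ)

/-- The orbit of a point of the level set. -/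
def orbitOf (κ : ℝ) (p : C4) (hp : p ∈ levelSet κ) : HKQuotient κ :=
  Quotient.mk (orbitSetoid κ) ⟨p, hp⟩

/-- The connection form of the circle bundle `μ⁻¹(0) → μ⁻¹(0) / U(1)`: its kernel is the
orthogonal complement of the orbits and it takes the value `1` on the generator. -/
def levelConnection (p X : C4) : ℝ :=
  flatMetric (generator p) X / flatMetric (generator p) (generator p)

/-- The horizontal part of a tangent vector. -/
def horizontal (p X : C4) : C4 := X - levelConnection p X • generator p

/-- The quotient metric induced by half the flat metric, as a bilinear form on tangent vectors
of the level set at `p`: half the flat inner product of the horizontal parts. -/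
def quotientMetric (p X Y : C4) : ℝ := (1 / 2) * flatMetric (horizontal p X) (horizontal p Y)

/-! ### The Eguchi-Hanson side -/

/-- `s = |z₁|² + |z₂|²`. -/
def radSq (z : C2) : ℝ := ‖z.1‖ ^ 2 + ‖z.2‖ ^ 2

/-- `F = √(1 + κ / s²)`. -/
def bigF (κ : ℝ) (z : C2) : ℝ := √(1 + κ / radSq z ^ 2)

/-- `f = F + √κ / s`. -/
def smallF (κ : ℝ) (z : C2) : ℝ := bigF κ z + √κ / radSq z

/-- The parametrisation `Z = z e^{iψ} f^{1/2}`, `W = (-z₂, z₁) e^{-iψ} f^{-1/2}`, a function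
of `x = (ψ, z)`. -/
def param (κ : ℝ) (x : ℝ × C2) : C4 :=
  ((x.2.1 * Complex.exp (Complex.I * x.1) * (√(smallF κ x.2) : ℝ),
    x.2.2 * Complex.exp (Complex.I * x.1) * (√(smallF κ x.2) : ℝ)),
   (-x.2.2 * Complex.exp (-(Complex.I * x.1)) * ((√(smallF κ x.2))⁻¹ : ℝ),
    x.2.1 * Complex.exp (-(Complex.I * x.1)) * ((√(smallF κ x.2))⁻¹ : ℝ)))

/-- `(z₁ dz₂ - z₂ dz₁)(v)`. -/
def alpha (z v : C2) : ℂ := z.1 * v.2 - z.2 * v.1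

/-- `(z̄₁ dz₁ + z̄₂ dz₂)(v)`. -/
def beta (z v : C2) : ℂ := conj z.1 * v.1 + conj z.2 * v.2

/-- The Eguchi-Hanson metric
`(1/s) (F |z₁ dz₂ - z₂ dz₁|² + F⁻¹ |z̄₁ dz₁ + z̄₂ dz₂|²)`, as a symmetric bilinear form. -/
def metricEH (κ : ℝ) (z u v : C2) : ℝ :=
  (1 / radSq z) * (bigF κ z * (alpha z u * conj (alpha z v)).re
    + (bigF κ z)⁻¹ * (beta z u * conj (beta z v)).re)

/-- The bilinear form `F (|dz₁|² + |dz₂|²) + (1/s) (F⁻¹ - F) |z̄₁ dz₁ + z̄₂ dz₂|²`. -/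
def metricHK (κ : ℝ) (z u v : C2) : ℝ :=
  bigF κ z * (u.1 * conj v.1 + u.2 * conj v.2).re
    + (1 / radSq z) * ((bigF κ z)⁻¹ - bigF κ z) * (beta z u * conj (beta z v)).re

/-- `A = √κ / (2 s² F) (z₁ dz̄₁ + z₂ dz̄₂)`. -/
def potentialA (κ : ℝ) (z v : C2) : ℂ :=
  ((√κ / (2 * radSq z ^ 2 * bigF κ z) : ℝ) : ℂ) * (z.1 * conj v.1 + z.2 * conj v.2)

/-- The connection `A - Ā`. -/
def connA (κ : ℝ) (z v : C2) : ℂ := potentialA κ z v - conj (potentialA κ z v)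

/-- The exterior derivative of a complex-valued 1-form on `ℂ² = ℝ⁴`. -/
def extDerivOne (a : C2 → C2 → ℂ) (z u v : C2) : ℂ :=
  fderiv ℝ (fun x => a x v) z u - fderiv ℝ (fun x => a x u) z v

/-! ### Anti-self-duality and pointwise norm of 2-forms on `ℝ⁴ = ℂ²` -/

/-- The real basis `∂/∂x₁, ∂/∂y₁, ∂/∂x₂, ∂/∂y₂`, which fixes the complex orientation. -/
def realBasis : Fin 4 → C2 := ![(1, 0), (Complex.I, 0), (0, 1), (0, Complex.I)]

/-- Coordinates with respect to `realBasis`. -/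
def realCoord (v : C2) : Fin 4 → ℝ := ![v.1.re, v.1.im, v.2.re, v.2.im]

/-- `e` is a `g`-orthonormal frame which is positive for the complex orientation. -/
def IsOrientedOrthonormalFrame (g : C2 → C2 → ℝ) (e : Fin 4 → C2) : Prop :=
  (∀ i j, g (e i) (e j) = if i = j then 1 else 0) ∧
    0 < (Matrix.of fun i j => realCoord (e i) j).det

/-- `⋆b = -b` for a 2-form `b`, where `⋆` is the Hodge star of the inner product `g` and the
complex orientation. The condition does not depend on the oriented orthonormal frame. -/
def IsAntiSelfDual (g : C2 → C2 → ℝ) (b : C2 → C2 → ℂ) : Prop :=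
  ∃ e : Fin 4 → C2, IsOrientedOrthonormalFrame g e ∧
    b (e 0) (e 1) = -b (e 2) (e 3) ∧
    b (e 0) (e 2) = -b (e 3) (e 1) ∧
    b (e 0) (e 3) = -b (e 1) (e 2)

/-- The matrix of `g` in the real basis. -/
def gram (g : C2 → C2 → ℝ) : Matrix (Fin 4) (Fin 4) ℝ :=
  Matrix.of fun i j => g (realBasis i) (realBasis j)

/-- The Riemannian volume density of `g` with respect to Lebesgue measure. -/
def volDensity (g : C2 → C2 → ℝ) : ℝ := √((gram g).det)

/-- The pointwise norm `|b|² = ½ gⁱᵏ gʲˡ b_{ij} b̄_{kl}` of a 2-form. -/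
def twoFormNormSq (g : C2 → C2 → ℝ) (b : C2 → C2 → ℂ) : ℝ :=
  (1 / 2) * ∑ i, ∑ j, ∑ k, ∑ l, (gram g)⁻¹ i k * (gram g)⁻¹ j l *
    (b (realBasis i) (realBasis j) * conj (b (realBasis k) (realBasis l))).re

end EguchiHanson

end

open EguchiHanson

namespace EguchiHanson


/-! ### The circle action and the moment map -/

/-! Everything rests on writing the parametrisation with one nonzero complex number
$c=e^{i\psi}f^{1/2}$: $Z=cz$ and $W=c^{-1}Jz$, where $Jz=(-z_2,z_1)$ (`param_eq_scale`). The complex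
moment equation says that $W$ is a multiple of $JZ$, and the real one fixes $|c|^2=f(z)$, because
$f$ is the positive root of $s(r-r^{-1})=2\sqrt\kappa$ (`smallF_unique`). Hence a point with
$W=\lambda JZ$, $\lambda\ne0$, determines $c^{-2}=\lambda$, so $c$ and $z=c^{-1}Z$ are determined up
to a common sign. This gives the image and the fibres, and a local branch of $\lambda^{1/2}$ gives
openness of the quotient coordinate.

For the metric, $dZ=c(v+\theta z)$ and $dW=c^{-1}J(v-\theta z)$ with $\theta=i\tau+d\log
f^{1/2}(v)$. Since $f+f^{-1}=2F$ and $f-f^{-1}=2\sqrt\kappa/s$, completing the square in $\tau$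
yields `half_flatMetric_fderiv_param`. As $\partial_\psi$ maps to the generator, the square is the
vertical part and the rest is the quotient metric.

The forms $\alpha=z_1dz_2-z_2dz_1$ and $\beta=\bar z_1dz_1+\bar z_2dz_2$ are a rescaled unitary
coframe. They diagonalise both the metric and the curvature (`extDerivOne_connA`), whose two
coefficients become opposite in an orthonormal frame: this is anti-self-duality. The frame has
determinant 1, so the volume is Lebesgue measure and $|d(A-\bar A)|^2=8\kappa/(s^2+\kappa)^2$, which
is bounded and decays like $|z|^{-8}$ in real dimension 4. -/

theorem hasDerivAt_circleAct (p : C4) :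
    HasDerivAt (fun t : ℝ => circleAct (Circle.exp t) p) (generator p) 0 := by
  have h1 : HasDerivAt (fun t : ℝ => Complex.exp (t * Complex.I)) Complex.I 0 := by
    have := ((Complex.ofRealCLM.hasDerivAt (x := (0 : ℝ))).mul_const Complex.I).cexp
    simpa using this
  have h2 : HasDerivAt (fun t : ℝ => Complex.exp (-(t * Complex.I))) (-Complex.I) 0 := by
    have := ((Complex.ofRealCLM.hasDerivAt (x := (0 : ℝ))).mul_const Complex.I).neg.cexp
    simpa using this
  have := (h1.smul_const p.1).prodMk (h2.smul_const p.2)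
  refine this.congr_of_eventuallyEq (Filter.Eventually.of_forall fun t => ?_)
  simp only [circleAct, Circle.coe_inv, Circle.coe_exp, Complex.exp_neg]

theorem mul_conj_coe_circle (u : Circle) : (u : ℂ) * conj (u : ℂ) = 1 := by
  rw [Complex.mul_conj]; simp

theorem flatMetric_circleAct (u : Circle) (X Y : C4) :
    flatMetric (circleAct u X) (circleAct u Y) = flatMetric X Y := by
  have h := mul_conj_coe_circle u
  simp only [flatMetric, circleAct, Circle.coe_inv_eq_conj, Prod.smul_fst, Prod.smul_snd,
    smul_eq_mul, map_mul, Complex.conj_conj]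
  congr 1
  linear_combination (X.1.1 * conj Y.1.1 + X.1.2 * conj Y.1.2 + X.2.1 * conj Y.2.1 +
    X.2.2 * conj Y.2.2) * h

theorem omegaR_circleAct (u : Circle) (X Y : C4) :
    omegaR (circleAct u X) (circleAct u Y) = omegaR X Y := by
  have h := mul_conj_coe_circle u
  simp only [omegaR, circleAct, Circle.coe_inv_eq_conj, Prod.smul_fst, Prod.smul_snd,
    smul_eq_mul, map_mul, Complex.conj_conj]
  congr 1
  linear_combination (conj X.1.1 * Y.1.1 + conj X.1.2 * Y.1.2 + conj X.2.1 * Y.2.1 +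
    conj X.2.2 * Y.2.2) * h

theorem omegaC_circleAct (u : Circle) (X Y : C4) :
    omegaC (circleAct u X) (circleAct u Y) = omegaC X Y := by
  have h := mul_conj_coe_circle u
  simp only [omegaC, circleAct, Circle.coe_inv_eq_conj, Prod.smul_fst, Prod.smul_snd,
    smul_eq_mul]
  linear_combination ((X.2.1 * Y.1.1 - Y.2.1 * X.1.1) + (X.2.2 * Y.1.2 - Y.2.2 * X.1.2)) * h

theorem moment_circleAct (κ : ℝ) (u : Circle) (p : C4) :
    moment κ (circleAct u p) = moment κ p := by
  have h := mul_conj_coe_circle u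
  refine Prod.ext ?_ ?_
  · simp [moment, muR, circleAct, Circle.norm_coe]
  · simp only [moment, muC, circleAct, Circle.coe_inv_eq_conj, Prod.smul_fst, Prod.smul_snd,
      smul_eq_mul]
    linear_combination (p.1.1 * p.2.1 + p.1.2 * p.2.2) * h

theorem generator_circleAct (u : Circle) (p : C4) :
    generator (circleAct u p) = circleAct u (generator p) := by
  simp [generator, circleAct, smul_smul, mul_comm]

theorem levelConnection_circleAct (u : Circle) (p X : C4) :
    levelConnection (circleAct u p) (circleAct u X) = levelConnection p X := by
  simp only [levelConnection, generator_circleAct, flatMetric_circleAct]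

theorem horizontal_circleAct (u : Circle) (p X : C4) :
    horizontal (circleAct u p) (circleAct u X) = circleAct u (horizontal p X) := by
  simp only [horizontal, levelConnection_circleAct, generator_circleAct]
  simp only [circleAct]
  refine Prod.ext ?_ ?_
  · simp only [Prod.fst_sub, Prod.smul_fst, smul_sub]
    rw [smul_comm]
  · simp only [Prod.snd_sub, Prod.smul_snd, smul_sub]
    rw [smul_comm]

theorem quotientMetric_circleAct (u : Circle) (p X Y : C4) :
    quotientMetric (circleAct u p) (circleAct u X) (circleAct u Y) = quotientMetric p X Y := by
  simp only [quotientMetric, horizontal_circleAct, flatMetric_circleAct]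

theorem hasFDerivAt_norm_sq_complex (w : ℂ) :
    HasFDerivAt (fun w : ℂ => ‖w‖ ^ 2) (2 • (innerSL ℝ w)) w :=
  (hasStrictFDerivAt_norm_sq w).hasFDerivAt

/-- The coordinate projections of `ℂ⁴`, as real linear maps. -/
noncomputable def coordZ₁ : C4 →L[ℝ] ℂ := (ContinuousLinearMap.fst ℝ ℂ ℂ).comp (.fst ℝ C2 C2)
/-- The second coordinate of `Z`. -/
noncomputable def coordZ₂ : C4 →L[ℝ] ℂ := (ContinuousLinearMap.snd ℝ ℂ ℂ).comp (.fst ℝ C2 C2)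
/-- The first coordinate of `W`. -/
noncomputable def coordW₁ : C4 →L[ℝ] ℂ := (ContinuousLinearMap.fst ℝ ℂ ℂ).comp (.snd ℝ C2 C2)
/-- The second coordinate of `W`. -/
noncomputable def coordW₂ : C4 →L[ℝ] ℂ := (ContinuousLinearMap.snd ℝ ℂ ℂ).comp (.snd ℝ C2 C2)

theorem hasFDerivAt_muR (κ : ℝ) (p : C4) :
    ∃ L : C4 →L[ℝ] ℝ, HasFDerivAt (muR κ) L p ∧
      ∀ X, L X = -2 * omegaR (generator p) X := by
  have h1 := (hasFDerivAt_norm_sq_complex (coordZ₁ p)).comp p coordZ₁.hasFDerivAt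
  have h2 := (hasFDerivAt_norm_sq_complex (coordZ₂ p)).comp p coordZ₂.hasFDerivAt
  have h3 := (hasFDerivAt_norm_sq_complex (coordW₁ p)).comp p coordW₁.hasFDerivAt
  have h4 := (hasFDerivAt_norm_sq_complex (coordW₂ p)).comp p coordW₂.hasFDerivAt
  refine ⟨_, ((h1.add h2).sub (h3.add h4)).sub_const (2 * √κ), fun X => ?_⟩
  simp [omegaR, generator, coordZ₁, coordZ₂, coordW₁, coordW₂, Complex.inner,
    innerSL_apply_apply]
  ring

theorem hasFDerivAt_muC (p : C4) :
    ∃ L : C4 →L[ℝ] ℂ, HasFDerivAt muC L p ∧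
      ∀ X, L X = Complex.I * omegaC (generator p) X := by
  have h1 := (coordZ₁.hasFDerivAt (x := p)).mul (coordW₁.hasFDerivAt (x := p))
  have h2 := (coordZ₂.hasFDerivAt (x := p)).mul (coordW₂.hasFDerivAt (x := p))
  refine ⟨_, h1.add h2, fun X => ?_⟩
  simp [omegaC, generator, coordZ₁, coordZ₂, coordW₁, coordW₂]
  linear_combination (p.1.1 * X.2.1 + X.1.1 * p.2.1 + p.1.2 * X.2.2 + X.1.2 * p.2.2) *
    Complex.I_mul_I

theorem fderiv_muR (κ : ℝ) (p X : C4) :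
    fderiv ℝ (muR κ) p X = -2 * omegaR (generator p) X := by
  obtain ⟨L, hL, h⟩ := hasFDerivAt_muR κ p
  rw [hL.fderiv, h]

theorem fderiv_muC (p X : C4) :
    fderiv ℝ muC p X = Complex.I * omegaC (generator p) X := by
  obtain ⟨L, hL, h⟩ := hasFDerivAt_muC p
  rw [hL.fderiv, h]

theorem differentiable_moment (κ : ℝ) : Differentiable ℝ (moment κ) := fun p =>
  ((hasFDerivAt_muR κ p).choose_spec.1.prodMk
    (hasFDerivAt_muC p).choose_spec.1).differentiableAt

theorem fderiv_moment (κ : ℝ) (p X : C4) :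
    fderiv ℝ (moment κ) p X =
      (-2 * omegaR (generator p) X, Complex.I * omegaC (generator p) X) := by
  obtain ⟨L, hL, h⟩ := hasFDerivAt_muR κ p
  obtain ⟨L', hL', h'⟩ := hasFDerivAt_muC p
  have : HasFDerivAt (moment κ) (L.prod L') p := hL.prodMk hL'
  rw [this.fderiv, ContinuousLinearMap.prod_apply, h, h']

theorem mem_levelSet {κ : ℝ} {p : C4} : p ∈ levelSet κ ↔ muR κ p = 0 ∧ muC p = 0 := by
  simp [levelSet, moment, Prod.ext_iff]

theorem radSq_nonneg (z : C2) : 0 ≤ radSq z := by unfold radSq; positivity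

theorem radSq_pos {z : C2} (hz : z ≠ 0) : 0 < radSq z := by
  refine lt_of_le_of_ne (radSq_nonneg z) fun h => hz ?_
  unfold radSq at h
  have h1 : ‖z.1‖ ^ 2 = 0 := by nlinarith [sq_nonneg ‖z.1‖, sq_nonneg ‖z.2‖]
  have h2 : ‖z.2‖ ^ 2 = 0 := by nlinarith [sq_nonneg ‖z.1‖, sq_nonneg ‖z.2‖]
  exact Prod.ext (by simpa using h1) (by simpa using h2)

theorem radSq_zero : radSq 0 = 0 := by simp [radSq]

theorem ofReal_radSq (z : C2) : (radSq z : ℂ) = z.1 * conj z.1 + z.2 * conj z.2 := by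
  simp [radSq, Complex.mul_conj, Complex.normSq_eq_norm_sq]

theorem radSq_fst_of_mem {κ : ℝ} {p : C4} (hp : p ∈ levelSet κ) :
    radSq p.1 = radSq p.2 + 2 * √κ := by
  have := (mem_levelSet.1 hp).1
  simp only [muR] at this
  simp only [radSq]; linarith

/-- The real moment equation gives $|Z|^2\ge2\sqrt\kappa$. Freeness, regularity and the definition
of `ratio` all depend on this bound. -/
theorem radSq_fst_pos {κ : ℝ} (hκ : 0 < κ) {p : C4} (hp : p ∈ levelSet κ) :
    0 < radSq p.1 := by
  have := radSq_fst_of_mem hp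
  have := radSq_nonneg p.2
  have := Real.sqrt_pos.2 hκ
  linarith

theorem fst_ne_zero_of_mem {κ : ℝ} (hκ : 0 < κ) {p : C4} (hp : p ∈ levelSet κ) : p.1 ≠ 0 := by
  intro h
  have := radSq_fst_pos hκ hp
  rw [h, radSq_zero] at this
  exact this.false

theorem circleAct_free {κ : ℝ} (hκ : 0 < κ) {p : C4} (hp : p ∈ levelSet κ) {u : Circle}
    (h : circleAct u p = p) : u = 1 := by
  have h1 : (u : ℂ) • p.1 = p.1 := congrArg Prod.fst h
  have h2 : ((u : ℂ) - 1) • p.1 = 0 := by rw [sub_smul, h1, one_smul, sub_self]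
  rcases smul_eq_zero.1 h2 with h3 | h3
  · exact Circle.ext (by simpa using sub_eq_zero.1 h3)
  · exact absurd h3 (fst_ne_zero_of_mem hκ hp)

theorem flatMetric_generator_self (p : C4) :
    flatMetric (generator p) (generator p) = radSq p.1 + radSq p.2 := by
  simp only [flatMetric, generator, radSq, ← Complex.normSq_eq_norm_sq, Complex.normSq_apply]
  simp
  ring

theorem levelConnection_generator {κ : ℝ} (hκ : 0 < κ) {p : C4} (hp : p ∈ levelSet κ) :
    levelConnection p (generator p) = 1 := by
  refine div_self ?_
  rw [flatMetric_generator_self]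
  have := radSq_fst_pos hκ hp
  have := radSq_nonneg p.2
  positivity

theorem surjective_fderiv_moment {κ : ℝ} (hκ : 0 < κ) {p : C4} (hp : p ∈ levelSet κ) :
    Function.Surjective (fderiv ℝ (moment κ) p) := by
  rintro ⟨a, d⟩
  have hN : 0 < radSq p.1 + radSq p.2 := by
    have := radSq_fst_pos hκ hp
    have := radSq_nonneg p.2
    positivity
  obtain ⟨N, hNe⟩ : ∃ N, N = radSq p.1 + radSq p.2 := ⟨_, rfl⟩
  rw [← hNe] at hN
  have hNC : (N : ℂ) ≠ 0 := by exact_mod_cast hN.ne'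
  have hC : (N : ℂ) = p.1.1 * conj p.1.1 + p.1.2 * conj p.1.2 +
      (p.2.1 * conj p.2.1 + p.2.2 * conj p.2.2) := by
    rw [hNe, Complex.ofReal_add, ofReal_radSq, ofReal_radSq]
  set c : ℝ := a / (2 * N)
  set e : ℂ := d / N
  -- The direction $(Z,-W)$ changes only $\mu_R$, at rate $2N$, and $(e\bar W,e\bar Z)$ changes only
  -- $\mu_C$, at rate $eN$; the cross terms cancel identically.
  refine ⟨((c * p.1.1 + e * conj p.2.1, c * p.1.2 + e * conj p.2.2),
    (-c * p.2.1 + e * conj p.1.1, -c * p.2.2 + e * conj p.1.2)), ?_⟩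
  rw [fderiv_moment]
  refine Prod.ext ?_ ?_
  · have ha : a = 2 * c * N := by simp only [c]; field_simp
    rw [ha, hNe]
    simp only [omegaR, generator, radSq, ← Complex.normSq_eq_norm_sq, Complex.normSq_apply]
    simp
    ring
  · have hd : d = e * N := by simp only [e]; field_simp
    simp only [omegaC, generator, Prod.smul_fst, Prod.smul_snd, smul_eq_mul]
    rw [hd, hC]
    linear_combination (-(e * (p.1.1 * conj p.1.1 + p.1.2 * conj p.1.2 +
      (p.2.1 * conj p.2.1 + p.2.2 * conj p.2.2)))) * Complex.I_mul_I


/-! ### The profile functions and the derivative of the parametrisation -/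

variable {κ : ℝ} {z : C2}

/-- No condition on $z$ is needed: at the origin the quotients by $s=0$ take the value 0, so $F=f=1$
there. -/
theorem bigF_pos (hκ : 0 < κ) (z : C2) : 0 < bigF κ z :=
  Real.sqrt_pos.2 (by positivity)

theorem bigF_sq (hκ : 0 < κ) (z : C2) : bigF κ z ^ 2 = 1 + κ / radSq z ^ 2 :=
  Real.sq_sqrt (by positivity)

theorem smallF_pos (hκ : 0 < κ) (z : C2) : 0 < smallF κ z :=
  add_pos_of_pos_of_nonneg (bigF_pos hκ z) (div_nonneg (Real.sqrt_nonneg _) (radSq_nonneg z))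

/-- Difference of squares: $F^2-(\sqrt\kappa/s)^2=1$. -/
theorem smallF_inv (hκ : 0 < κ) (z : C2) :
    (smallF κ z)⁻¹ = bigF κ z - √κ / radSq z := by
  refine inv_eq_of_mul_eq_one_right ?_
  have h := bigF_sq hκ z
  have hk : √κ ^ 2 = κ := Real.sq_sqrt hκ.le
  have : (√κ / radSq z) ^ 2 = κ / radSq z ^ 2 := by rw [div_pow, hk]
  unfold smallF
  linear_combination h - this

theorem contDiff_radSq : ContDiff ℝ ∞ radSq :=
  ((contDiff_norm_sq ℝ).comp contDiff_fst).add ((contDiff_norm_sq ℝ).comp contDiff_snd)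

theorem contDiffAt_bigF (hκ : 0 < κ) (hz : z ≠ 0) : ContDiffAt ℝ ∞ (bigF κ) z := by
  refine ContDiffAt.sqrt (contDiffAt_const.add (contDiffAt_const.div
    (contDiff_radSq.contDiffAt.pow 2) (pow_ne_zero 2 (radSq_pos hz).ne'))) ?_
  positivity

theorem contDiffAt_smallF (hκ : 0 < κ) (hz : z ≠ 0) : ContDiffAt ℝ ∞ (smallF κ) z :=
  (contDiffAt_bigF hκ hz).add
    (contDiffAt_const.div contDiff_radSq.contDiffAt (radSq_pos hz).ne')

/-- The complex scale factor `e^{iψ} f^{1/2}`. -/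
noncomputable def scale (κ : ℝ) (x : ℝ × C2) : ℂ :=
  Complex.exp (Complex.I * x.1) * (√(smallF κ x.2) : ℝ)

theorem scale_ne_zero (hκ : 0 < κ) (x : ℝ × C2) : scale κ x ≠ 0 :=
  mul_ne_zero (Complex.exp_ne_zero _)
    (by exact_mod_cast (Real.sqrt_pos.2 (smallF_pos hκ x.2)).ne')

/-- Merging phase and radius into one complex factor makes the later identities rational in that
factor. -/
theorem param_eq_scale (κ : ℝ) (x : ℝ × C2) :
    param κ x = ((x.2.1 * scale κ x, x.2.2 * scale κ x),
      (-x.2.2 * (scale κ x)⁻¹, x.2.1 * (scale κ x)⁻¹)) := by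
  simp only [param, scale, Complex.exp_neg, Complex.ofReal_inv, mul_inv, mul_assoc]

theorem scale_mul_conj (hκ : 0 < κ) (x : ℝ × C2) :
    scale κ x * conj (scale κ x) = smallF κ x.2 := by
  rw [Complex.mul_conj, scale, Complex.normSq_mul, Complex.normSq_ofReal,
    Real.mul_self_sqrt (smallF_pos hκ x.2).le, Complex.normSq_eq_norm_sq, mul_comm Complex.I,
    Complex.norm_exp_ofReal_mul_I]
  simp

theorem norm_scale_sq (hκ : 0 < κ) (x : ℝ × C2) : ‖scale κ x‖ ^ 2 = smallF κ x.2 := by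
  have := scale_mul_conj hκ x
  rw [Complex.mul_conj, Complex.normSq_eq_norm_sq] at this
  exact_mod_cast this

theorem contDiffAt_scale (hκ : 0 < κ) {x : ℝ × C2} (hx : x.2 ≠ 0) :
    ContDiffAt ℝ ∞ (scale κ) x := by
  refine ContDiffAt.mul ?_ ?_
  · exact (contDiffAt_const.mul
      (Complex.ofRealCLM.contDiff.contDiffAt.comp x contDiffAt_fst)).cexp
  · refine Complex.ofRealCLM.contDiff.contDiffAt.comp x (ContDiffAt.sqrt ?_ ?_)
    · exact (contDiffAt_smallF hκ hx).comp x contDiffAt_snd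
    · exact (smallF_pos hκ _).ne'

theorem contDiffAt_param (hκ : 0 < κ) {x : ℝ × C2} (hx : x.2 ≠ 0) :
    ContDiffAt ℝ ∞ (param κ) x := by
  have hc := contDiffAt_scale hκ hx
  have hi := hc.inv (scale_ne_zero hκ x)
  have h1 : ContDiffAt ℝ ∞ (fun x : ℝ × C2 => x.2.1) x := by fun_prop
  have h2 : ContDiffAt ℝ ∞ (fun x : ℝ × C2 => x.2.2) x := by fun_prop
  rw [funext (param_eq_scale κ)]
  exact ((h1.mul hc).prodMk (h2.mul hc)).prodMk ((h2.neg.mul hi).prodMk (h1.mul hi))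

theorem contDiffOn_param (hκ : 0 < κ) : ContDiffOn ℝ ∞ (param κ) {x | x.2 ≠ 0} :=
  fun _ hx => (contDiffAt_param hκ hx).contDiffWithinAt

/-- Derivatives are computed along real lines; smoothness then identifies them with values of
`fderiv`. -/
theorem hasDerivAt_add_smul {E : Type*} [NormedAddCommGroup E] [NormedSpace ℝ E] (a v : E) :
    HasDerivAt (fun t : ℝ => a + t • v) v 0 := by
  simpa using ((hasDerivAt_id (0 : ℝ)).smul_const v).const_add a

theorem hasDerivAt_radSq (z v : C2) :
    HasDerivAt (fun t : ℝ => radSq (z + t • v)) (2 * (beta z v).re) 0 := by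
  have h1 := (hasDerivAt_add_smul z.1 v.1).norm_sq
  have h2 := (hasDerivAt_add_smul z.2 v.2).norm_sq
  refine (h1.add h2).congr_deriv ?_
  simp [beta, Complex.inner]
  ring

theorem hasDerivAt_bigF (hκ : 0 < κ) (hz : z ≠ 0) (v : C2) :
    HasDerivAt (fun t : ℝ => bigF κ (z + t • v))
      (-(2 * κ * (beta z v).re / (radSq z ^ 3 * bigF κ z))) 0 := by
  have hs := (radSq_pos hz).ne'
  have h0 : z + (0 : ℝ) • v = z := by simp
  have h := (((hasDerivAt_radSq z v).fun_pow 2).fun_inv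
    (by rw [h0]; exact pow_ne_zero 2 hs)).const_mul κ
  have h' := (h.const_add 1).sqrt (by rw [h0]; positivity)
  refine h'.congr_deriv ?_
  have hF := (bigF_pos hκ z).ne'
  simp only [h0, ← div_eq_mul_inv]
  change _ / (2 * bigF κ z) = _
  simp
  field_simp

/-- The logarithmic derivative of `f^{1/2}` along `v`. -/
noncomputable def logScale (κ : ℝ) (z v : C2) : ℝ :=
  -(√κ / (radSq z ^ 2 * bigF κ z) * (beta z v).re)

/-- The derivatives of $F$ and of $\sqrt\kappa/s$ have the common factor
$-2\sqrt\kappa\,\mathrm{Re}\,\beta/(s^2F)$, and the cofactors add up to $f$ itself. -/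
theorem hasDerivAt_smallF (hκ : 0 < κ) (hz : z ≠ 0) (v : C2) :
    HasDerivAt (fun t : ℝ => smallF κ (z + t • v)) (2 * logScale κ z v * smallF κ z) 0 := by
  have hs := (radSq_pos hz).ne'
  have hF := (bigF_pos hκ z).ne'
  have h0 : z + (0 : ℝ) • v = z := by simp
  have h := ((hasDerivAt_radSq z v).fun_inv (by rwa [h0])).const_mul (√κ)
  refine ((hasDerivAt_bigF hκ hz v).add h).congr_deriv ?_
  have hk : √κ ^ 2 = κ := Real.sq_sqrt hκ.le
  simp only [h0, logScale, smallF]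
  field_simp
  linear_combination (beta z v).re * hk

theorem hasDerivAt_scale (hκ : 0 < κ) (hz : z ≠ 0) (ψ τ : ℝ) (v : C2) :
    HasDerivAt (fun t : ℝ => scale κ (ψ + t * τ, z + t • v))
      (scale κ (ψ, z) * (Complex.I * τ + logScale κ z v)) 0 := by
  have h0 : z + (0 : ℝ) • v = z := by simp
  have hf := smallF_pos hκ z
  have h1 := (hasDerivAt_smallF hκ hz v).sqrt (by rw [h0]; exact hf.ne')
  have h2 := h1.ofReal_comp
  have h3 : HasDerivAt (fun t : ℝ => Complex.exp (Complex.I * ((ψ + t * τ : ℝ) : ℂ)))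
      (Complex.exp (Complex.I * ψ) * (Complex.I * τ)) 0 := by
    have : HasDerivAt (fun t : ℝ => ψ + t * τ) τ 0 := by
      simpa using ((hasDerivAt_id (0 : ℝ)).mul_const τ).const_add ψ
    simpa using (this.ofReal_comp.const_mul Complex.I).cexp
  refine (h3.mul h2).congr_deriv ?_
  simp only [h0, scale]
  have hq : (√(smallF κ z) : ℂ) ≠ 0 := by exact_mod_cast (Real.sqrt_pos.2 hf).ne'
  have hq2 : (smallF κ z : ℂ) = (√(smallF κ z) : ℂ) ^ 2 := by
    exact_mod_cast (Real.sq_sqrt hf.le).symm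
  push_cast
  simp only [zero_mul, add_zero]
  field_simp
  linear_combination (logScale κ z v : ℂ) * hq2

/-- The derivative of the parametrisation: with `c = e^{iψ} f^{1/2}` and
`θ = iτ + d(log f^{1/2})(v)`, one has `dZ = c (v + θ z)` and `dW = c⁻¹ (Jv - θ Jz)`. -/
theorem fderiv_param (hκ : 0 < κ) (hz : z ≠ 0) (ψ τ : ℝ) (v : C2) :
    fderiv ℝ (param κ) (ψ, z) (τ, v) =
      ((scale κ (ψ, z) * (v.1 + z.1 * (Complex.I * τ + logScale κ z v)),
        scale κ (ψ, z) * (v.2 + z.2 * (Complex.I * τ + logScale κ z v))),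
       ((scale κ (ψ, z))⁻¹ * (-(v.2 - z.2 * (Complex.I * τ + logScale κ z v))),
        (scale κ (ψ, z))⁻¹ * (v.1 - z.1 * (Complex.I * τ + logScale κ z v)))) := by
  have hd : DifferentiableAt ℝ (param κ) (ψ, z) :=
    (contDiffAt_param hκ (x := (ψ, z)) hz).differentiableAt (by simp)
  have hl := hd.hasFDerivAt.hasLineDerivAt (τ, v)
  have hc := hasDerivAt_scale hκ hz ψ τ v
  have hne := scale_ne_zero hκ (ψ, z)
  have hi := hc.fun_inv (by simpa using hne)
  have h1 := hasDerivAt_add_smul z.1 v.1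
  have h2 := hasDerivAt_add_smul z.2 v.2
  have h := ((h1.mul hc).prodMk (h2.mul hc)).prodMk ((h2.neg.mul hi).prodMk (h1.mul hi))
  have hl' : HasDerivAt (fun t : ℝ => param κ ((ψ, z) + t • (τ, v)))
      (fderiv ℝ (param κ) (ψ, z) (τ, v)) 0 := hl
  rw [funext fun t => param_eq_scale κ ((ψ, z) + t • (τ, v))] at hl'
  refine (hl'.unique h).trans ?_
  simp only [zero_mul, add_zero, zero_smul]
  refine Prod.ext (Prod.ext ?_ ?_) (Prod.ext ?_ ?_)
  · simp; ring
  · simp; ring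
  · simp; field_simp; ring
  · simp; field_simp; ring

/-! ### The pull-back of the flat metric, the connection form and the quotient metric -/

/-- The real one-form `i (A - Ā)`. -/
noncomputable def realConn (κ : ℝ) (z v : C2) : ℝ :=
  √κ / (radSq z ^ 2 * bigF κ z) * (beta z v).im

/-- Since $A$ is a real multiple of $\bar\beta$, the difference $A-\bar A$ only sees
$\mathrm{Im}\,\beta$. This allows real arithmetic from here on. -/
theorem I_mul_connA (κ : ℝ) (z v : C2) : Complex.I * connA κ z v = realConn κ z v := by
  have e : √κ / (2 * radSq z ^ 2 * bigF κ z) = √κ / (radSq z ^ 2 * bigF κ z) / 2 := by ring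
  rw [connA, potentialA, realConn, beta, e]
  generalize √κ / (radSq z ^ 2 * bigF κ z) = m
  simp only [map_mul, Complex.conj_ofReal]
  apply Complex.ext
  · simp only [← mul_sub, Complex.mul_re, Complex.I_re, Complex.I_im, Complex.ofReal_re,
      Complex.im_ofReal_mul]
    simp
    ring
  · simp only [← mul_sub, Complex.mul_im, Complex.I_re, Complex.I_im, Complex.ofReal_im,
      Complex.re_ofReal_mul]
    simp

theorem beta_re_eq (z u v : C2) : (beta z u * conj (beta z v)).re =
    (beta z u).re * (beta z v).re + (beta z u).im * (beta z v).im := by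
  simp

/-- Half the flat metric, pulled back by the parametrisation. -/
theorem half_flatMetric_fderiv_param (hκ : 0 < κ) (hz : z ≠ 0) (ψ τ τ' : ℝ) (v v' : C2) :
    (1 / 2) * flatMetric (fderiv ℝ (param κ) (ψ, z) (τ, v))
        (fderiv ℝ (param κ) (ψ, z) (τ', v')) =
      metricHK κ z v v' + radSq z * bigF κ z *
        ((τ + realConn κ z v) * (τ' + realConn κ z v')) := by
  have hs := (radSq_pos hz).ne'
  have hF := (bigF_pos hκ z).ne'
  have hF2 := bigF_sq hκ z
  have hk : √κ ^ 2 = κ := Real.sq_sqrt hκ.le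
  have hc := scale_mul_conj hκ (ψ, z)
  have hci : (scale κ (ψ, z))⁻¹ * conj (scale κ (ψ, z))⁻¹ =
      ((bigF κ z - √κ / radSq z : ℝ) : ℂ) := by
    rw [← smallF_inv hκ z, map_inv₀, ← mul_inv, hc, Complex.ofReal_inv]
  rw [fderiv_param hκ hz, fderiv_param hκ hz]
  set c := scale κ (ψ, z)
  set h := logScale κ z v with hh
  set h' := logScale κ z v' with hh'
  -- The $Z$ part is weighted by $|c|^2=f$ and the $W$ part by $f^{-1}$. The even terms in $\theta$
  -- receive $f+f^{-1}=2F$, the terms linear in $\theta$ receive $f-f^{-1}=2\sqrt\kappa/s$.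
  have key : flatMetric
      ((c * (v.1 + z.1 * (Complex.I * τ + h)), c * (v.2 + z.2 * (Complex.I * τ + h))),
        (c⁻¹ * (-(v.2 - z.2 * (Complex.I * τ + h))), c⁻¹ * (v.1 - z.1 * (Complex.I * τ + h))))
      ((c * (v'.1 + z.1 * (Complex.I * τ' + h')), c * (v'.2 + z.2 * (Complex.I * τ' + h'))),
        (c⁻¹ * (-(v'.2 - z.2 * (Complex.I * τ' + h'))),
          c⁻¹ * (v'.1 - z.1 * (Complex.I * τ' + h')))) =
      2 * bigF κ z * ((v.1 * conj v'.1 + v.2 * conj v'.2).re + radSq z * (h * h' + τ * τ')) +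
      2 * (√κ / radSq z) * ((beta z v').re * h + (beta z v').im * τ +
        (beta z v).re * h' + (beta z v).im * τ') := by
    have e : ∀ a b a' b' p q p' q' : ℂ, flatMetric ((c * a, c * b), (c⁻¹ * p, c⁻¹ * q))
        ((c * a', c * b'), (c⁻¹ * p', c⁻¹ * q')) =
        (bigF κ z + √κ / radSq z) * (a * conj a' + b * conj b').re +
        (bigF κ z - √κ / radSq z) * (p * conj p' + q * conj q').re := by
      intro a b a' b' p q p' q'
      rw [← Complex.re_ofReal_mul, ← Complex.re_ofReal_mul, ← hci, ← smallF, ← hc,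
        ← Complex.add_re, flatMetric]
      simp only [map_mul]
      congr 1
      ring
    rw [e]
    simp only [radSq, ← Complex.normSq_eq_norm_sq, Complex.normSq_apply, beta]
    simp
    ring
  rw [key, metricHK, beta_re_eq]
  simp only [hh, hh', logScale, realConn]
  -- The radial terms and the completed square each leave $-\kappa/(s^3F)=(F^{-1}-F)/s$, in front of
  -- the real and the imaginary parts of $\beta$ respectively.
  have hκ' : κ = (bigF κ z ^ 2 - 1) * radSq z ^ 2 := by rw [hF2]; field_simp; ring
  replace hk := hk.trans hκ'
  field_simp
  linear_combination (- ((beta z v).re * (beta z v').re + (beta z v).im * (beta z v').im)) * hk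

theorem ofReal_half_flatMetric_fderiv_param (hκ : 0 < κ) (hz : z ≠ 0) (ψ τ τ' : ℝ)
    (v v' : C2) :
    (((1 / 2) * flatMetric (fderiv ℝ (param κ) (ψ, z) (τ, v))
          (fderiv ℝ (param κ) (ψ, z) (τ', v')) : ℝ) : ℂ) =
        (metricHK κ z v v' : ℂ) + (radSq z * bigF κ z : ℝ) *
          ((τ + Complex.I * connA κ z v) * (τ' + Complex.I * connA κ z v')) := by
  rw [half_flatMetric_fderiv_param hκ hz, I_mul_connA, I_mul_connA]
  push_cast
  ring

/-- Lagrange's identity, polarised: $v\mapsto s^{-1/2}(\alpha(v),\beta(v))$ is unitary. -/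
theorem radSq_mul_re (z u v : C2) : radSq z * (u.1 * conj v.1 + u.2 * conj v.2).re =
    (alpha z u * conj (alpha z v)).re + (beta z u * conj (beta z v)).re := by
  simp only [radSq, ← Complex.normSq_eq_norm_sq, Complex.normSq_apply, alpha, beta]
  simp
  ring

theorem metricHK_eq_metricEH (κ : ℝ) (hz : z ≠ 0) (u v : C2) :
    metricHK κ z u v = metricEH κ z u v := by
  have hs := (radSq_pos hz).ne'
  have h := radSq_mul_re z u v
  have h' : (u.1 * conj v.1 + u.2 * conj v.2).re =
    ((alpha z u * conj (alpha z v)).re + (beta z u * conj (beta z v)).re) / radSq z := by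
    rw [← h]; field_simp
  rw [metricHK, metricEH, h']
  ring

theorem generator_param (hκ : 0 < κ) (hz : z ≠ 0) (ψ : ℝ) :
    generator (param κ (ψ, z)) = fderiv ℝ (param κ) (ψ, z) (1, 0) := by
  rw [fderiv_param hκ hz, param_eq_scale]
  have : logScale κ z 0 = 0 := by simp [logScale, beta]
  simp only [this, generator]
  refine Prod.ext (Prod.ext ?_ ?_) (Prod.ext ?_ ?_) <;> simp <;> ring

theorem metricHK_zero_left (κ : ℝ) (z v : C2) : metricHK κ z 0 v = 0 := by
  simp [metricHK, beta]

theorem realConn_zero (κ : ℝ) (z : C2) : realConn κ z 0 = 0 := by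
  simp [realConn, beta]

/-- The generator is the image of $(1,0)$, on which the base metric vanishes, so both pairings
reduce to the square term and the common factor $2sF$ cancels. -/
theorem levelConnection_fderiv_param (hκ : 0 < κ) (hz : z ≠ 0) (ψ τ : ℝ) (v : C2) :
    levelConnection (param κ (ψ, z)) (fderiv ℝ (param κ) (ψ, z) (τ, v)) =
      τ + realConn κ z v := by
  have h1 := half_flatMetric_fderiv_param hκ hz ψ 1 τ 0 v
  have h2 := half_flatMetric_fderiv_param hκ hz ψ 1 1 0 0
  rw [metricHK_zero_left, realConn_zero] at h1 h2
  have hsF : 0 < radSq z * bigF κ z := mul_pos (radSq_pos hz) (bigF_pos hκ z)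
  rw [levelConnection, generator_param hκ hz, div_eq_iff (by nlinarith)]
  linear_combination 2 * h1 - 2 * (τ + realConn κ z v) * h2

theorem quotientMetric_fderiv_param (hκ : 0 < κ) (hz : z ≠ 0) (ψ τ τ' : ℝ) (v v' : C2) :
    quotientMetric (param κ (ψ, z)) (fderiv ℝ (param κ) (ψ, z) (τ, v))
        (fderiv ℝ (param κ) (ψ, z) (τ', v')) = metricEH κ z v v' := by
  -- The horizontal lift of $v$ has $\tau=-i(A-\bar A)(v)$, which makes the square term vanish.
  have h : ∀ (τ : ℝ) (v : C2),
      horizontal (param κ (ψ, z)) (fderiv ℝ (param κ) (ψ, z) (τ, v)) =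
        fderiv ℝ (param κ) (ψ, z) (-realConn κ z v, v) := by
    intro τ v
    rw [horizontal, levelConnection_fderiv_param hκ hz, generator_param hκ hz, ← map_smul,
      ← map_sub]
    congr 1
    simp
  rw [quotientMetric, h, h, half_flatMetric_fderiv_param hκ hz, metricHK_eq_metricEH κ hz]
  ring


/-! ### The image of the parametrisation -/

theorem radSq_smul (a : ℂ) (z : C2) : radSq (a • z) = ‖a‖ ^ 2 * radSq z := by
  simp [radSq]; ring

theorem muR_eq_radSq (κ : ℝ) (p : C4) : muR κ p = radSq p.1 - radSq p.2 - 2 * √κ := rfl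

theorem param_mem_levelSet (hκ : 0 < κ) (hz : z ≠ 0) (ψ : ℝ) :
    param κ (ψ, z) ∈ levelSet κ := by
  have hs := (radSq_pos hz).ne'
  rw [mem_levelSet, param_eq_scale]
  constructor
  · have h1 : ‖scale κ (ψ, z)‖ ^ 2 = smallF κ z := norm_scale_sq hκ _
    have h2 := smallF_inv hκ z
    simp only [muR, norm_mul, norm_inv, norm_neg, mul_pow, inv_pow, h1, h2]
    simp only [smallF, ← add_mul]
    rw [add_comm (‖z.2‖ ^ 2) (‖z.1‖ ^ 2)]
    change radSq z * _ - radSq z * _ - _ = _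
    field_simp
    ring
  · simp only [muC]; ring

theorem param_snd_ne_zero (hκ : 0 < κ) (hz : z ≠ 0) (ψ : ℝ) : (param κ (ψ, z)).2 ≠ 0 := by
  have hc := inv_ne_zero (scale_ne_zero hκ (ψ, z))
  rw [param_eq_scale]
  intro h
  have h1 := congrArg Prod.fst h
  have h2 := congrArg Prod.snd h
  refine hz (Prod.ext ?_ ?_)
  · simpa [hc] using h2
  · simpa [hc] using h1

/-- $r\mapsto r-r^{-1}$ is injective on the positive reals: a difference of two values is
$(f-r)(1+f^{-1}r^{-1})$ with positive second factor. -/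
theorem smallF_unique (hκ : 0 < κ) (hz : z ≠ 0) {r : ℝ} (hr : 0 < r)
    (h : radSq z * (r - r⁻¹) = 2 * √κ) : smallF κ z = r := by
  have hs := (radSq_pos hz).ne'
  have hf := smallF_pos hκ z
  have hi := smallF_inv hκ z
  have h1 : smallF κ z - (smallF κ z)⁻¹ = r - r⁻¹ := by
    have h' : r - r⁻¹ = 2 * √κ / radSq z := by rw [← h]; field_simp
    rw [hi, h']
    simp only [smallF]; ring
  have h2 : (smallF κ z - r) * (1 + (smallF κ z)⁻¹ * r⁻¹) = 0 := by
    have : (smallF κ z - r) * (1 + (smallF κ z)⁻¹ * r⁻¹) =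
        (smallF κ z - (smallF κ z)⁻¹) - (r - r⁻¹) := by field_simp; ring
    rw [this, h1, sub_self]
  rcases mul_eq_zero.1 h2 with h3 | h3
  · linarith
  · have : 0 < 1 + (smallF κ z)⁻¹ * r⁻¹ := by positivity
    exact absurd h3 this.ne'

/-- A point of the level set with `W = d² (-Z₂, Z₁)` has coordinates `z = d Z`. -/
theorem exists_param_eq (hκ : 0 < κ) {p : C4} (hp : p ∈ levelSet κ) {d : ℂ} (hd : d ≠ 0)
    (h1 : p.2.1 = -(d ^ 2 * p.1.2)) (h2 : p.2.2 = d ^ 2 * p.1.1) :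
    d • p.1 ≠ 0 ∧ ∃ ψ : ℝ, param κ (ψ, d • p.1) = p := by
  have hz : d • p.1 ≠ 0 := smul_ne_zero hd (fst_ne_zero_of_mem hκ hp)
  -- The goal forces the scale factor to be $d^{-1}$; its modulus is matched through $f=|d|^{-2}$
  -- and its argument is $\psi$.
  refine ⟨hz, Complex.arg d⁻¹, ?_⟩
  have hn : 0 < ‖d⁻¹‖ := norm_pos_iff.2 (inv_ne_zero hd)
  have hf : smallF κ (d • p.1) = ‖d⁻¹‖ ^ 2 := by
    refine smallF_unique hκ hz (by positivity) ?_
    have h := radSq_fst_of_mem hp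
    have hW : radSq p.2 = ‖d‖ ^ 4 * radSq p.1 := by
      simp only [radSq, h1, h2, norm_neg, norm_mul, norm_pow]; ring
    have hd' : ‖d‖ ≠ 0 := norm_ne_zero_iff.2 hd
    rw [radSq_smul, norm_inv]
    rw [hW] at h
    field_simp
    linarith
  have hc : scale κ (Complex.arg d⁻¹, d • p.1) = d⁻¹ := by
    simp only [scale]
    rw [hf, Real.sqrt_sq hn.le, mul_comm Complex.I, mul_comm, Complex.norm_mul_exp_arg_mul_I]
  rw [param_eq_scale, hc]
  refine Prod.ext (Prod.ext ?_ ?_) (Prod.ext ?_ ?_)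
  · simp; field_simp
  · simp; field_simp
  · simp [h1]; ring
  · simp [h2]; ring

/-- The factor `λ` with `W = λ (-Z₂, Z₁)` on the level set. -/
noncomputable def ratio (p : C4) : ℂ :=
  (conj p.1.1 * p.2.2 - conj p.1.2 * p.2.1) / (radSq p.1 : ℂ)

/-- $\mu_C=0$ puts $W$ in the bilinear annihilator of $Z\ne0$, which is the complex line of
$(-Z_2,Z_1)$; the coefficient is read off by the Hermitian product. -/
theorem snd_eq_ratio (hκ : 0 < κ) {p : C4} (hp : p ∈ levelSet κ) :
    p.2.1 = -(ratio p * p.1.2) ∧ p.2.2 = ratio p * p.1.1 := by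
  have hC : p.1.1 * p.2.1 + p.1.2 * p.2.2 = 0 := (mem_levelSet.1 hp).2
  have hs : (radSq p.1 : ℂ) ≠ 0 := by exact_mod_cast (radSq_fst_pos hκ hp).ne'
  have hs' := ofReal_radSq p.1
  constructor
  · rw [ratio]
    field_simp
    rw [hs']
    linear_combination conj p.1.1 * hC
  · rw [ratio]
    field_simp
    rw [hs']
    linear_combination conj p.1.2 * hC

theorem ratio_ne_zero (hκ : 0 < κ) {p : C4} (hp : p ∈ levelSet κ) (hW : p.2 ≠ 0) :
    ratio p ≠ 0 := by
  obtain ⟨h1, h2⟩ := snd_eq_ratio hκ hp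
  intro h
  rw [h] at h1 h2
  exact hW (Prod.ext (by simpa using h1) (by simpa using h2))

theorem image_param (hκ : 0 < κ) :
    param κ '' {x | x.2 ≠ 0} = {p | p ∈ levelSet κ ∧ p.2 ≠ 0} := by
  ext p
  constructor
  · rintro ⟨⟨ψ, z⟩, hz, rfl⟩
    exact ⟨param_mem_levelSet hκ hz ψ, param_snd_ne_zero hκ hz ψ⟩
  · rintro ⟨hp, hW⟩
    -- Either square root works; the choice is the sign ambiguity of $z$.
    obtain ⟨d, hd⟩ := IsAlgClosed.exists_pow_nat_eq (ratio p) two_pos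
    have hd0 : d ≠ 0 := by
      rintro rfl
      exact ratio_ne_zero hκ hp hW (by simpa using hd.symm)
    obtain ⟨h1, h2⟩ := snd_eq_ratio hκ hp
    rw [← hd] at h1 h2
    obtain ⟨hz, ψ, h⟩ := exists_param_eq hκ hp hd0 h1 h2
    exact ⟨(ψ, d • p.1), hz, h⟩

theorem radSq_neg (z : C2) : radSq (-z) = radSq z := by simp [radSq]

theorem smallF_neg (κ : ℝ) (z : C2) : smallF κ (-z) = smallF κ z := by
  simp [smallF, bigF, radSq_neg]

theorem param_eq_param_iff (hκ : 0 < κ) (ψ ψ' : ℝ) {z z' : C2} (hz : z ≠ 0) :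
    param κ (ψ, z) = param κ (ψ', z') ↔
        (z' = z ∧ Complex.exp (Complex.I * ψ') = Complex.exp (Complex.I * ψ)) ∨
        (z' = -z ∧ Complex.exp (Complex.I * ψ') = -Complex.exp (Complex.I * ψ)) := by
  have hf : (√(smallF κ z) : ℂ) ≠ 0 := by
    exact_mod_cast (Real.sqrt_pos.2 (smallF_pos hκ z)).ne'
  constructor
  · intro h
    rw [param_eq_scale, param_eq_scale] at h
    have hc := scale_ne_zero hκ (ψ, z)
    have hc' := scale_ne_zero hκ (ψ', z')
    simp only [Prod.mk.injEq] at h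
    obtain ⟨⟨h1, h2⟩, h3, h4⟩ := h
    have hsc : ∀ ψ z, scale κ (ψ, z) = Complex.exp (Complex.I * ψ) * (√(smallF κ z) : ℝ) :=
      fun _ _ => rfl
    generalize hcd : scale κ (ψ, z) = c at h1 h2 h3 h4 hc
    generalize hcd' : scale κ (ψ', z') = c' at h1 h2 h3 h4 hc'
    rw [hsc] at hcd hcd'
    field_simp at h3 h4
    -- Combining $zc=z'c'$ with $Jz\,c^{-1}=Jz'\,c'^{-1}$ eliminates $z'$, using whichever
    -- coordinate of $z$ is nonzero.
    have hsq : c ^ 2 = c' ^ 2 := by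
      by_cases ha : z.1 = 0
      · have hb : z.2 ≠ 0 := fun hb => hz (Prod.ext ha hb)
        apply mul_left_cancel₀ hb
        linear_combination c * h2 + c' * h3
      · apply mul_left_cancel₀ ha
        linear_combination c * h1 - c' * h4
    rcases sq_eq_sq_iff_eq_or_eq_neg.1 hsq with h | h
    · left
      rw [h] at h1 h2
      have hzz : z' = z := Prod.ext (mul_right_cancel₀ hc' h1.symm) (mul_right_cancel₀ hc' h2.symm)
      refine ⟨hzz, ?_⟩
      rw [hzz] at hcd'
      exact mul_right_cancel₀ hf (by rw [hcd, hcd', h])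
    · right
      rw [h] at h1 h2
      have hzz : z' = -z := by
        refine Prod.ext (mul_right_cancel₀ hc' ?_) (mul_right_cancel₀ hc' ?_)
        · rw [← h1, Prod.fst_neg]; ring
        · rw [← h2, Prod.snd_neg]; ring
      refine ⟨hzz, ?_⟩
      rw [hzz, smallF_neg] at hcd'
      exact mul_right_cancel₀ hf (by rw [neg_mul, hcd, hcd', h, neg_neg])
  · rintro (⟨rfl, h⟩ | ⟨rfl, h⟩)
    · simp only [param_eq_scale, scale, h]
    · simp only [param_eq_scale, scale, h, smallF_neg, Prod.fst_neg, Prod.snd_neg, neg_mul,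
        inv_neg, mul_neg, neg_neg]

theorem param_add (κ t ψ : ℝ) (z : C2) :
    param κ (ψ + t, z) = circleAct (Circle.exp t) (param κ (ψ, z)) := by
  have h : scale κ (ψ + t, z) = (Circle.exp t : ℂ) * scale κ (ψ, z) := by
    simp only [scale, Circle.coe_exp, ← mul_assoc, ← Complex.exp_add]
    congr 2
    push_cast
    ring
  simp only [param_eq_scale, h, circleAct, Circle.coe_inv, mul_inv]
  refine Prod.ext (Prod.ext ?_ ?_) (Prod.ext ?_ ?_) <;> simp <;> ring

/-! ### The parametrisation is an immersion onto the tangent spaces of the level set -/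

/-- Positive definiteness: both squares must vanish, and $\alpha(v)=\beta(v)=0$ gives $s|v|^2=0$.
The inequality is what remains after a nonnegative square is dropped from a zero sum. -/
theorem metricEH_self_eq_zero (hκ : 0 < κ) (hz : z ≠ 0) {v : C2}
    (h : metricEH κ z v v ≤ 0) : v = 0 := by
  have hs := radSq_pos hz
  have hF := bigF_pos hκ z
  rw [metricEH] at h
  simp only [Complex.mul_conj, Complex.ofReal_re] at h
  have ha := Complex.normSq_nonneg (alpha z v)
  have hb := Complex.normSq_nonneg (beta z v)
  have h' : bigF κ z * Complex.normSq (alpha z v) +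
      (bigF κ z)⁻¹ * Complex.normSq (beta z v) ≤ 0 := by
    by_contra hc
    exact absurd h (not_le.2 (mul_pos (by positivity) (not_le.1 hc)))
  have h1 : 0 ≤ bigF κ z * Complex.normSq (alpha z v) := by positivity
  have h2 : 0 ≤ (bigF κ z)⁻¹ * Complex.normSq (beta z v) := by positivity
  have ha0 : Complex.normSq (alpha z v) = 0 :=
    (mul_eq_zero.1 (by linarith : bigF κ z * Complex.normSq (alpha z v) = 0)).resolve_left hF.ne'
  have hb0 : Complex.normSq (beta z v) = 0 :=
    (mul_eq_zero.1 (by linarith : (bigF κ z)⁻¹ * Complex.normSq (beta z v) = 0)).resolve_left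
      (inv_ne_zero hF.ne')
  have hv : radSq v = 0 := by
    have hr' := radSq_mul_re z v v
    rw [← ofReal_radSq, Complex.mul_conj, Complex.mul_conj] at hr'
    simp only [Complex.ofReal_re] at hr'
    rw [ha0, hb0] at hr'
    simpa [hs.ne'] using hr'
  by_contra hne
  exact absurd hv (radSq_pos hne).ne'

theorem injective_fderiv_param (hκ : 0 < κ) (hz : z ≠ 0) (ψ : ℝ) :
    Function.Injective (fderiv ℝ (param κ) (ψ, z)) := by
  rw [injective_iff_map_eq_zero]
  rintro ⟨τ, v⟩ h
  have h1 := half_flatMetric_fderiv_param hκ hz ψ τ τ v v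
  rw [h, metricHK_eq_metricEH κ hz] at h1
  have h0 : flatMetric 0 0 = 0 := by simp [flatMetric]
  have hsF : 0 < radSq z * bigF κ z := mul_pos (radSq_pos hz) (bigF_pos hκ z)
  have hq := mul_nonneg hsF.le (mul_self_nonneg (τ + realConn κ z v))
  have hv : v = 0 := metricEH_self_eq_zero hκ hz (by rw [h0] at h1; linarith)
  subst hv
  have hm : metricEH κ z 0 0 = 0 := by simp [metricEH, alpha, beta]
  rw [h0, hm, realConn_zero] at h1
  have : (τ + 0) * (τ + 0) = 0 :=
    (mul_eq_zero.1 (by linarith : radSq z * bigF κ z * ((τ + 0) * (τ + 0)) = 0)).resolve_left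
      hsF.ne'
  exact Prod.ext (by simpa using this) rfl

theorem range_fderiv_param (hκ : 0 < κ) (hz : z ≠ 0) (ψ : ℝ) :
    Set.range (fderiv ℝ (param κ) (ψ, z)) =
      {X | fderiv ℝ (moment κ) (param κ (ψ, z)) X = 0} := by
  have hd : DifferentiableAt ℝ (param κ) (ψ, z) :=
    (contDiffAt_param hκ (x := (ψ, z)) hz).differentiableAt (by simp)
  set P := fderiv ℝ (param κ) (ψ, z) with hP
  set M := fderiv ℝ (moment κ) (param κ (ψ, z)) with hM
  -- $\mu\circ\Phi$ vanishes near the point, so the range lies in the kernel; both have dimension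
  -- $5=8-3$.
  have hcomp : M.comp P = 0 := by
    rw [hM, hP, ← fderiv_comp _ (differentiable_moment κ _) hd]
    have : moment κ ∘ param κ =ᶠ[nhds (ψ, z)] fun _ => 0 := by
      have ho : IsOpen {x : ℝ × C2 | x.2 ≠ 0} := isOpen_ne_fun continuous_snd continuous_const
      filter_upwards [ho.mem_nhds (show (ψ, z) ∈ {x : ℝ × C2 | x.2 ≠ 0} from hz)] with x hx
      exact param_mem_levelSet hκ hx x.1
    rw [this.fderiv_eq]
    simp
  have hle : P.toLinearMap.range ≤ M.toLinearMap.ker := by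
    rintro _ ⟨x, rfl⟩
    exact DFunLike.congr_fun hcomp x
  have hr : Module.finrank ℝ P.toLinearMap.range = 5 := by
    rw [LinearMap.finrank_range_of_inj (injective_fderiv_param hκ hz ψ)]
    simp
  have hk : Module.finrank ℝ M.toLinearMap.ker = 5 := by
    have h1 := M.toLinearMap.finrank_range_add_finrank_ker
    have h2 : M.toLinearMap.range = ⊤ := LinearMap.range_eq_top.2
      (surjective_fderiv_moment hκ (param_mem_levelSet hκ hz ψ))
    rw [h2, finrank_top] at h1
    simp at h1
    omega
  have := Submodule.eq_of_le_of_finrank_eq hle (hr.trans hk.symm)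
  ext X
  exact SetLike.ext_iff.1 this X

/-! ### The coordinates on the quotient -/

/-- The map from `ℂ² ∖ {0}` to the hyperkähler quotient. -/
noncomputable def toQuotient (hκ : 0 < κ) (z : {z : C2 // z ≠ 0}) : HKQuotient κ :=
  orbitOf κ (param κ (0, z.1)) (param_mem_levelSet hκ z.2 0)

theorem orbitOf_eq_iff {p q : C4} (hp : p ∈ levelSet κ) (hq : q ∈ levelSet κ) :
    orbitOf κ p hp = orbitOf κ q hq ↔ ∃ u : Circle, circleAct u p = q :=
  Quotient.eq (r := orbitSetoid κ)

theorem toQuotient_eq_orbitOf_iff (hκ : 0 < κ) (z : {z : C2 // z ≠ 0}) {p : C4}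
    (hp : p ∈ levelSet κ) :
    toQuotient hκ z = orbitOf κ p hp ↔ ∃ ψ : ℝ, param κ (ψ, z.1) = p := by
  rw [toQuotient, orbitOf_eq_iff]
  constructor
  · rintro ⟨u, hu⟩
    refine ⟨Complex.arg u, ?_⟩
    rw [← hu, ← zero_add (Complex.arg u), param_add, Circle.exp_arg]
  · rintro ⟨ψ, h⟩
    refine ⟨Circle.exp ψ, ?_⟩
    rw [← param_add, zero_add, h]

theorem toQuotient_eq_iff (hκ : 0 < κ) (z z' : {z : C2 // z ≠ 0}) :
    toQuotient hκ z = toQuotient hκ z' ↔ z'.1 = z.1 ∨ z'.1 = -z.1 := by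
  rw [toQuotient.eq_1 hκ z', toQuotient_eq_orbitOf_iff]
  constructor
  · rintro ⟨ψ, h⟩
    exact ((param_eq_param_iff hκ ψ 0 z.2).1 h).imp And.left And.left
  · rintro (h | h)
    · exact ⟨0, by rw [h]⟩
    -- A half turn of the circle compensates the sign of $z$.
    · refine ⟨Real.pi, (param_eq_param_iff hκ _ 0 z.2).2 (Or.inr ⟨h, ?_⟩)⟩
      rw [mul_comm, mul_comm Complex.I, Complex.exp_pi_mul_I]
      simp

theorem orbitOf_mem_range_iff (hκ : 0 < κ) {p : C4} (hp : p ∈ levelSet κ) :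
    orbitOf κ p hp ∈ Set.range (toQuotient hκ) ↔ p.2 ≠ 0 := by
  constructor
  · rintro ⟨z, h⟩
    obtain ⟨ψ, rfl⟩ := (toQuotient_eq_orbitOf_iff hκ z hp).1 h
    exact param_snd_ne_zero hκ z.2 ψ
  · intro hW
    have : p ∈ param κ '' {x | x.2 ≠ 0} := by rw [image_param hκ]; exact ⟨hp, hW⟩
    obtain ⟨⟨ψ, z⟩, hz, h⟩ := this
    exact ⟨⟨z, hz⟩, (toQuotient_eq_orbitOf_iff hκ _ hp).2 ⟨ψ, h⟩⟩

theorem continuous_orbitMk (κ : ℝ) : Continuous (Quotient.mk (orbitSetoid κ)) :=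
  continuous_quotient_mk'

theorem continuous_toQuotient (hκ : 0 < κ) : Continuous (toQuotient hκ) := by
  refine (continuous_orbitMk κ).comp (Continuous.subtype_mk ?_ _)
  rw [continuous_iff_continuousAt]
  intro z
  exact (contDiffAt_param hκ (x := (0, z.1)) z.2).continuousAt.comp
    (f := fun z : {z : C2 // z ≠ 0} => ((0 : ℝ), z.1)) (by fun_prop)

theorem continuousAt_ratio {p : C4} (hp : p.1 ≠ 0) : ContinuousAt ratio p := by
  have h : Continuous radSq := contDiff_radSq.continuous
  unfold ratio
  refine ContinuousAt.div ?_ ?_ ?_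
  · refine Continuous.continuousAt ?_
    fun_prop
  · exact (Complex.continuous_ofReal.comp (h.comp continuous_fst)).continuousAt
  · exact_mod_cast (radSq_pos hp).ne'

theorem ratio_param (hκ : 0 < κ) (hz : z ≠ 0) (ψ : ℝ) :
    ratio (param κ (ψ, z)) = (scale κ (ψ, z))⁻¹ ^ 2 := by
  have hc := scale_ne_zero hκ (ψ, z)
  obtain ⟨h1, h2⟩ := snd_eq_ratio hκ (param_mem_levelSet hκ hz ψ)
  generalize ratio (param κ (ψ, z)) = r at h1 h2 ⊢
  simp only [param_eq_scale] at h1 h2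
  by_cases ha : z.1 = 0
  · have hb : z.2 ≠ 0 := fun hb => hz (Prod.ext ha hb)
    refine mul_right_cancel₀ (mul_ne_zero hb hc) ?_
    field_simp at h1 ⊢
    linear_combination h1
  · refine mul_right_cancel₀ (mul_ne_zero ha hc) ?_
    field_simp at h2 ⊢
    linear_combination -h2

/-- The coordinate has a local continuous lift: near a point over $z$, a branch $g$ of the square
root of `ratio` makes $q\mapsto g(q)Z(q)$ a coordinate of the orbit of $q$, and it stays in any
given neighbourhood of $z$. -/
theorem isOpenMap_toQuotient (hκ : 0 < κ) : IsOpenMap (toQuotient hκ) := by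
  intro U hU
  obtain ⟨V, hV, rfl⟩ := isOpen_induced_iff.1 hU
  rw [← (isQuotientMap_quotient_mk' (s := orbitSetoid κ)).isOpen_preimage, isOpen_iff_mem_nhds]
  rintro ⟨p, hp⟩ ⟨z, hzV, hzp⟩
  obtain ⟨ψ, hψ⟩ := (toQuotient_eq_orbitOf_iff hκ z hp).1 hzp
  have hc := scale_ne_zero hκ (ψ, z.1)
  set c := scale κ (ψ, z.1) with hcdef
  have hrp : ratio p = c⁻¹ ^ 2 := by rw [← hψ, ratio_param hκ z.2]
  have hrp0 : ratio p ≠ 0 := by rw [hrp]; exact pow_ne_zero 2 (inv_ne_zero hc)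
  have hcr : ContinuousAt (fun q : levelSet κ => ratio q.1) ⟨p, hp⟩ :=
    (continuousAt_ratio (fst_ne_zero_of_mem hκ hp)).comp_of_eq
      continuous_subtype_val.continuousAt rfl
  -- Dividing by the value at $p$ moves the base point to 1, where the principal root is continuous;
  -- the prefactor selects the branch giving $z$ rather than $-z$.
  let g : levelSet κ → ℂ := fun q => c⁻¹ * (ratio q.1 / ratio p) ^ (1 / 2 : ℂ)
  have hg : ContinuousAt g ⟨p, hp⟩ := by
    refine continuousAt_const.mul (ContinuousAt.cpow (hcr.div_const _) continuousAt_const ?_)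
    simp [div_self hrp0, Complex.one_mem_slitPlane]
  have hgp : g ⟨p, hp⟩ = c⁻¹ := by simp [g, div_self hrp0]
  have hgsq : ∀ q, g q ^ 2 = ratio q.1 := by
    intro q
    have : ((ratio q.1 / ratio p) ^ (1 / 2 : ℂ)) ^ 2 = ratio q.1 / ratio p := by
      rw [one_div]
      exact Complex.cpow_nat_inv_pow _ two_ne_zero
    simp only [g, mul_pow, this, ← hrp]
    field_simp
  have hz0 : g ⟨p, hp⟩ • p.1 = z.1 := by
    rw [hgp, ← hψ, param_eq_scale, ← hcdef]
    refine Prod.ext ?_ ?_ <;> simp <;> field_simp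
  have hcont : ContinuousAt (fun q : levelSet κ => g q • q.1.1) ⟨p, hp⟩ :=
    hg.smul (continuous_fst.comp continuous_subtype_val).continuousAt
  have hVn : V ∈ nhds (g ⟨p, hp⟩ • p.1) := by rw [hz0]; exact hV.mem_nhds hzV
  filter_upwards [hcont hVn, hcr.eventually_ne hrp0] with q hqV hq0
  have hgq : g q ≠ 0 := by
    intro h
    have := hgsq q
    rw [h] at this
    exact hq0 (by simpa using this.symm)
  obtain ⟨h1, h2⟩ := snd_eq_ratio hκ q.2
  rw [← hgsq q] at h1 h2
  obtain ⟨hz', ψ', h'⟩ := exists_param_eq hκ q.2 hgq h1 h2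
  exact ⟨⟨_, hz'⟩, hqV, (toQuotient_eq_orbitOf_iff hκ _ q.2).2 ⟨ψ', h'⟩⟩

theorem denseRange_toQuotient (hκ : 0 < κ) : DenseRange (toQuotient hκ) := by
  intro q
  induction q using Quotient.inductionOn with
  | h p =>
  obtain ⟨p, hp⟩ := p
  change orbitOf κ p hp ∈ _
  by_cases hW : p.2 = 0
  swap
  · exact subset_closure ((orbitOf_mem_range_iff hκ hp).2 hW)
  -- A curve in the level set leaving a point with $W=0$: the increase $t^2|Z|^2$ of the first norm
  -- squared equals that of the second.
  let γ : ℝ → C4 := fun t => (((√(1 + t ^ 2) : ℝ) : ℂ) • p.1, (t : ℂ) • (-p.1.2, p.1.1))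
  have hpos : ∀ t : ℝ, 0 ≤ 1 + t ^ 2 := fun t => by positivity
  have hγ : ∀ t, γ t ∈ levelSet κ := by
    intro t
    have h := radSq_fst_of_mem hp
    rw [hW, radSq_zero] at h
    rw [mem_levelSet]
    constructor
    · have hJ : radSq ((-p.1.2, p.1.1) : C2) = radSq p.1 := by simp [radSq, add_comm]
      simp only [γ, muR_eq_radSq, radSq_smul, hJ, Complex.norm_real, Real.norm_eq_abs, sq_abs,
        Real.sq_sqrt (hpos t)]
      linarith
    · simp [γ, muC]; ring
  have hcont : Continuous fun t : ℝ => (⟨γ t, hγ t⟩ : levelSet κ) := by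
    refine Continuous.subtype_mk ?_ _
    fun_prop
  have h0 : (⟨γ 0, hγ 0⟩ : levelSet κ) = ⟨p, hp⟩ := by
    refine Subtype.ext (Prod.ext ?_ ?_)
    · simp [γ]
    · simp [γ, hW]
  have ht := (((continuous_orbitMk κ).comp hcont).tendsto 0).mono_left
    (nhdsWithin_le_nhds (s := {0}ᶜ))
  simp only [Function.comp_def, h0] at ht
  refine mem_closure_of_tendsto ht ?_
  filter_upwards [self_mem_nhdsWithin] with t ht0
  refine (orbitOf_mem_range_iff hκ (hγ t)).2 ?_
  refine smul_ne_zero (by exact_mod_cast ht0) fun h => fst_ne_zero_of_mem hκ hp ?_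
  refine Prod.ext (congrArg Prod.snd h) ?_
  simpa using congrArg Prod.fst h


/-! ### The curvature -/

theorem connA_eq (κ : ℝ) (z v : C2) : connA κ z v = -Complex.I * realConn κ z v := by
  rw [← I_mul_connA, ← mul_assoc]; simp

theorem contDiffAt_realConn (hκ : 0 < κ) (hz : z ≠ 0) (v : C2) :
    ContDiffAt ℝ ∞ (fun z => realConn κ z v) z := by
  have hs := (radSq_pos hz).ne'
  refine ContDiffAt.mul (contDiffAt_const.div
    ((contDiff_radSq.contDiffAt.pow 2).mul (contDiffAt_bigF hκ hz))
    (mul_ne_zero (pow_ne_zero 2 hs) (bigF_pos hκ z).ne')) ?_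
  have h1 : ContDiff ℝ ∞ (fun z : C2 => conj z.1) :=
    Complex.conjCLE.contDiff.comp contDiff_fst
  have h2 : ContDiff ℝ ∞ (fun z : C2 => conj z.2) :=
    Complex.conjCLE.contDiff.comp contDiff_snd
  exact (Complex.imCLM.contDiff.comp
    ((h1.mul contDiff_const).add (h2.mul contDiff_const))).contDiffAt

theorem contDiffAt_connA (hκ : 0 < κ) (hz : z ≠ 0) (v : C2) :
    ContDiffAt ℝ ∞ (fun z => connA κ z v) z := by
  simp only [connA_eq]
  exact contDiffAt_const.mul
    (Complex.ofRealCLM.contDiff.contDiffAt.comp z (contDiffAt_realConn hκ hz v))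

theorem contDiffOn_connA (hκ : 0 < κ) (v : C2) :
    ContDiffOn ℝ ∞ (fun z => connA κ z v) {z | z ≠ 0} :=
  fun _ hz => (contDiffAt_connA hκ hz v).contDiffWithinAt

theorem radSq_sq_mul_bigF_sq (hκ : 0 < κ) (hz : z ≠ 0) :
    radSq z ^ 2 * bigF κ z ^ 2 = radSq z ^ 2 + κ := by
  have hs := (radSq_pos hz).ne'
  rw [bigF_sq hκ]
  field_simp

/-- Product rule: the coefficient $\sqrt\kappa/(s^2F)$ depends on $s$ only, with
$ds=2\,\mathrm{Re}\,\beta$, while $\beta$ is additive and real homogeneous in its base point. -/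
theorem hasDerivAt_realConn (hκ : 0 < κ) (hz : z ≠ 0) (u v : C2) :
    HasDerivAt (fun t : ℝ => realConn κ (z + t • u) v)
      (-(2 * √κ * (2 * radSq z ^ 2 + κ) / (radSq z ^ 5 * bigF κ z ^ 3)) * (beta z u).re *
        (beta z v).im + √κ / (radSq z ^ 2 * bigF κ z) * (beta u v).im) 0 := by
  have hs := (radSq_pos hz).ne'
  have hF := (bigF_pos hκ z).ne'
  have h0 : z + (0 : ℝ) • u = z := by simp
  have h1 := ((((hasDerivAt_radSq z u).fun_pow 2).fun_mul (hasDerivAt_bigF hκ hz u)).fun_inv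
    (by rw [h0]; positivity)).const_mul (√κ)
  have h2 : HasDerivAt (fun t : ℝ => (beta (z + t • u) v).im) (beta u v).im 0 := by
    have e : (fun t : ℝ => (beta (z + t • u) v).im) =
        fun t => (beta z v).im + t • (beta u v).im := by
      funext t
      simp [beta]
      ring
    rw [e]
    exact hasDerivAt_add_smul _ _
  refine (h1.mul h2).congr_deriv ?_
  simp only [h0]
  have hsF := radSq_sq_mul_bigF_sq hκ hz
  have hκ' : κ = radSq z ^ 2 * bigF κ z ^ 2 - radSq z ^ 2 := by linarith
  generalize √κ = k
  generalize bigF κ z = F at *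
  subst hκ'
  field_simp
  ring

theorem fderiv_connA (hκ : 0 < κ) (hz : z ≠ 0) (u v : C2) :
    fderiv ℝ (fun x => connA κ x v) z u = -Complex.I *
      ((-(2 * √κ * (2 * radSq z ^ 2 + κ) / (radSq z ^ 5 * bigF κ z ^ 3)) * (beta z u).re *
        (beta z v).im + √κ / (radSq z ^ 2 * bigF κ z) * (beta u v).im : ℝ) : ℂ) := by
  have hl := ((contDiffAt_connA hκ hz v).differentiableAt
    (by simp)).hasFDerivAt.hasLineDerivAt u
  have hl' : HasDerivAt (fun t : ℝ => connA κ (z + t • u) v)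
      (fderiv ℝ (fun x => connA κ x v) z u) 0 := hl
  simp only [connA_eq] at hl' ⊢
  exact hl'.unique ((hasDerivAt_realConn hκ hz u v).ofReal_comp.const_mul _)

/-- The coefficients of the curvature in terms of `z₁ dz₂ - z₂ dz₁` and `z̄₁ dz₁ + z̄₂ dz₂`. -/
theorem extDerivOne_connA (hκ : 0 < κ) (hz : z ≠ 0) (u v : C2) :
    extDerivOne (connA κ) z u v = -Complex.I *
      ((2 * √κ / radSq z ^ 3 * ((bigF κ z)⁻¹ * (conj (alpha z u) * alpha z v).im -
        (bigF κ z)⁻¹ ^ 3 * (conj (beta z u) * beta z v).im) : ℝ) : ℂ) := by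
  have hs := (radSq_pos hz).ne'
  have hF := (bigF_pos hκ z).ne'
  rw [extDerivOne, fderiv_connA hκ hz, fderiv_connA hκ hz, ← mul_sub, ← Complex.ofReal_sub]
  congr 2
  have h1 : (beta v u).im = -(beta u v).im := by simp [beta]; ring
  -- The imaginary counterpart of Lagrange's identity, expressing the flat Kähler form through
  -- $\alpha$ and $\beta$.
  have h2 : radSq z * (beta u v).im =
      (conj (alpha z u) * alpha z v).im + (conj (beta z u) * beta z v).im := by
    simp only [radSq, ← Complex.normSq_eq_norm_sq, Complex.normSq_apply, alpha, beta]
    simp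
    ring
  have h3 : (conj (beta z u) * beta z v).im =
      (beta z u).re * (beta z v).im - (beta z u).im * (beta z v).re := by simp; ring
  have h2' : (conj (alpha z u) * alpha z v).im =
      radSq z * (beta u v).im - (conj (beta z u) * beta z v).im := by linarith
  have hsF := radSq_sq_mul_bigF_sq hκ hz
  -- The $\beta$ coefficient simplifies through $s^2F^2-(2s^2+\kappa)=-s^2$, the source of the sign
  -- and of $F^{-3}$.
  have hκ' : κ = radSq z ^ 2 * bigF κ z ^ 2 - radSq z ^ 2 := by linarith
  rw [h1, h2', h3]
  generalize √κ = k
  generalize bigF κ z = F at *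
  subst hκ'
  field_simp
  ring

/-! ### The orthonormal frame -/

/-- An oriented orthonormal frame of the Eguchi-Hanson metric. -/
noncomputable def frameEH (κ : ℝ) (z : C2) : Fin 4 → C2 :=
  ![((√(radSq z * bigF κ z))⁻¹ : ℂ) • (-conj z.2, conj z.1),
    (Complex.I * (√(radSq z * bigF κ z))⁻¹ : ℂ) • (-conj z.2, conj z.1),
    (√(bigF κ z / radSq z) : ℂ) • z,
    (Complex.I * √(bigF κ z / radSq z) : ℂ) • z]

theorem alpha_smul (z v : C2) (c : ℂ) : alpha z (c • v) = c * alpha z v := by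
  simp [alpha]; ring

theorem beta_smul (z v : C2) (c : ℂ) : beta z (c • v) = c * beta z v := by
  simp [beta]; ring

theorem alpha_self (z : C2) : alpha z z = 0 := by simp [alpha]; ring

theorem beta_self (z : C2) : beta z z = radSq z := by rw [ofReal_radSq, beta]; ring

theorem alpha_dual (z : C2) : alpha z (-conj z.2, conj z.1) = radSq z := by
  rw [ofReal_radSq, alpha]; ring

theorem beta_dual (z : C2) : beta z (-conj z.2, conj z.1) = 0 := by simp [beta]; ring

/-- The values of `z₁ dz₂ - z₂ dz₁` on the frame, up to the factor `(s / F)^{1/2}`. -/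
theorem alpha_frameEH (hκ : 0 < κ) (hz : z ≠ 0) (i : Fin 4) :
    alpha z (frameEH κ z i) = (√(radSq z / bigF κ z) : ℝ) * ![1, Complex.I, 0, 0] i := by
  have hs := radSq_pos hz
  have hF := bigF_pos hκ z
  have h : (√(radSq z * bigF κ z))⁻¹ * radSq z = √(radSq z / bigF κ z) := by
    rw [Real.sqrt_mul hs.le, Real.sqrt_div hs.le]
    nth_rewrite 2 [← Real.mul_self_sqrt hs.le]
    have := Real.sqrt_pos.2 hs
    have := Real.sqrt_pos.2 hF
    field_simp
  have h' : ((√(radSq z * bigF κ z) : ℂ))⁻¹ * radSq z = (√(radSq z / bigF κ z) : ℝ) := by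
    rw [← h]; push_cast; rfl
  fin_cases i
  · exact (alpha_smul _ _ _).trans (by simp [alpha_dual, ← h'])
  · exact (alpha_smul _ _ _).trans (by simp [alpha_dual, ← h']; ring)
  · exact (alpha_smul _ _ _).trans (by simp [alpha_self])
  · exact (alpha_smul _ _ _).trans (by simp [alpha_self])

/-- The values of `z̄₁ dz₁ + z̄₂ dz₂` on the frame, up to the factor `(s F)^{1/2}`. -/
theorem beta_frameEH (hκ : 0 < κ) (hz : z ≠ 0) (i : Fin 4) :
    beta z (frameEH κ z i) = (√(radSq z * bigF κ z) : ℝ) * ![0, 0, 1, Complex.I] i := by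
  have hs := radSq_pos hz
  have hF := bigF_pos hκ z
  have h : √(bigF κ z / radSq z) * radSq z = √(radSq z * bigF κ z) := by
    rw [Real.sqrt_mul hs.le, Real.sqrt_div hF.le]
    nth_rewrite 2 [← Real.mul_self_sqrt hs.le]
    have := Real.sqrt_pos.2 hs
    field_simp
  have h' : (√(bigF κ z / radSq z) : ℂ) * radSq z = (√(radSq z * bigF κ z) : ℝ) := by
    rw [← h]; push_cast; rfl
  fin_cases i
  · exact (beta_smul _ _ _).trans (by simp [beta_dual])
  · exact (beta_smul _ _ _).trans (by simp [beta_dual])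
  · exact (beta_smul _ _ _).trans (by simp [beta_self, ← h'])
  · exact (beta_smul _ _ _).trans (by simp [beta_self, ← h']; ring)

theorem metricEH_frameEH (hκ : 0 < κ) (hz : z ≠ 0) (i j : Fin 4) :
    metricEH κ z (frameEH κ z i) (frameEH κ z j) = if i = j then 1 else 0 := by
  have hs := radSq_pos hz
  have hF := bigF_pos hκ z
  have h1 : (√(radSq z / bigF κ z)) * (√(radSq z / bigF κ z)) = radSq z / bigF κ z :=
    Real.mul_self_sqrt (by positivity)
  have h2 : (√(radSq z * bigF κ z)) * (√(radSq z * bigF κ z)) = radSq z * bigF κ z :=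
    Real.mul_self_sqrt (by positivity)
  have e : ∀ (a : ℝ) (x y : ℂ), ((a : ℂ) * x * conj ((a : ℂ) * y)).re =
      a * a * (x * conj y).re := by
    intro a x y
    simp; ring
  rw [metricEH, alpha_frameEH hκ hz, alpha_frameEH hκ hz, beta_frameEH hκ hz,
    beta_frameEH hκ hz, e, e, h1, h2]
  fin_cases i <;> fin_cases j <;> simp <;> field_simp

/-- The factors of the two complex lines cancel: $(sF)^{-1}\cdot(F/s)\cdot s^2=1$. The exact value,
beyond its sign, gives the volume density. -/
theorem det_frameEH (hκ : 0 < κ) (hz : z ≠ 0) :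
    (Matrix.of fun i j => realCoord (frameEH κ z i) j).det = 1 := by
  have hs := radSq_pos hz
  have hF := bigF_pos hκ z
  have h1 : (√(radSq z * bigF κ z))⁻¹ ^ 2 * √(bigF κ z / radSq z) ^ 2 * radSq z ^ 2 = 1 := by
    rw [inv_pow, Real.sq_sqrt (by positivity), Real.sq_sqrt (by positivity)]
    field_simp
  rw [← h1]
  simp only [frameEH, ← Complex.ofReal_inv]
  generalize (√(radSq z * bigF κ z))⁻¹ = a
  generalize √(bigF κ z / radSq z) = d
  simp only [radSq, ← Complex.normSq_eq_norm_sq, Complex.normSq_apply]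
  simp [Matrix.det_succ_row_zero, Fin.sum_univ_succ, realCoord, Fin.succAbove]
  ring

theorem isOrientedOrthonormalFrame_frameEH (hκ : 0 < κ) (hz : z ≠ 0) :
    IsOrientedOrthonormalFrame (metricEH κ z) (frameEH κ z) :=
  ⟨metricEH_frameEH hκ hz, by rw [det_frameEH hκ hz]; exact one_pos⟩

/-- The matrix of the curvature in the frame. -/
theorem extDerivOne_connA_frameEH (hκ : 0 < κ) (hz : z ≠ 0) (i j : Fin 4) :
    extDerivOne (connA κ) z (frameEH κ z i) (frameEH κ z j) =
      -Complex.I * ((2 * √κ / (radSq z ^ 2 + κ) : ℝ) : ℂ) *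
        ((![![0, 1, 0, 0], ![-1, 0, 0, 0], ![0, 0, 0, -1], ![0, 0, 1, 0]] : Fin 4 → Fin 4 → ℝ)
          i j : ℝ) := by
  have hs := radSq_pos hz
  have hF := bigF_pos hκ z
  have h1 : (√(radSq z / bigF κ z)) * (√(radSq z / bigF κ z)) = radSq z / bigF κ z :=
    Real.mul_self_sqrt (by positivity)
  have h2 : (√(radSq z * bigF κ z)) * (√(radSq z * bigF κ z)) = radSq z * bigF κ z :=
    Real.mul_self_sqrt (by positivity)
  have e : ∀ (a : ℝ) (x y : ℂ), (conj ((a : ℂ) * x) * ((a : ℂ) * y)).im =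
      a * a * (conj x * y).im := by
    intro a x y
    simp; ring
  -- The weights $F^{-1}\cdot s/F$ and $F^{-3}\cdot sF$ coincide, so the two blocks have equal size
  -- and opposite sign, with $s^2F^2=s^2+\kappa$ in the denominator.
  rw [extDerivOne_connA hκ hz, alpha_frameEH hκ hz, alpha_frameEH hκ hz, beta_frameEH hκ hz,
    beta_frameEH hκ hz, e, e, h1, h2, mul_assoc (-Complex.I), ← Complex.ofReal_mul,
    ← radSq_sq_mul_bigF_sq hκ hz]
  congr 2
  fin_cases i <;> fin_cases j <;> simp <;> field_simp

theorem isAntiSelfDual_extDerivOne_connA (hκ : 0 < κ) (hz : z ≠ 0) :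
    IsAntiSelfDual (metricEH κ z) (extDerivOne (connA κ) z) := by
  refine ⟨frameEH κ z, isOrientedOrthonormalFrame_frameEH hκ hz, ?_, ?_, ?_⟩ <;>
    simp [extDerivOne_connA_frameEH hκ hz]

/-! ### Norms of two-forms in an orthonormal frame -/

theorem sum_realCoord_smul (v : C2) : ∑ i, realCoord v i • realBasis i = v := by
  simp only [Fin.sum_univ_four, realCoord, realBasis]
  refine Prod.ext ?_ ?_
  · apply Complex.ext <;> simp
  · apply Complex.ext <;> simp

theorem bilin_eq_sum {M : Type*} [AddCommGroup M] [Module ℝ M]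
    (b : C2 →ₗ[ℝ] C2 →ₗ[ℝ] M) (u v : C2) :
    b u v = ∑ i, ∑ j, (realCoord u i * realCoord v j) • b (realBasis i) (realBasis j) := by
  conv_lhs => rw [← sum_realCoord_smul u, ← sum_realCoord_smul v]
  simp only [map_sum, map_smul, LinearMap.sum_apply, LinearMap.smul_apply, Finset.smul_sum,
    smul_smul]
  rw [Finset.sum_comm]
  simp only [mul_comm]

/-- The matrix of a frame with respect to the real basis. -/
def frameMatrix (e : Fin 4 → C2) : Matrix (Fin 4) (Fin 4) ℝ :=
  Matrix.of fun i j => realCoord (e i) j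

theorem frameMatrix_mul_gram (g : C2 →ₗ[ℝ] C2 →ₗ[ℝ] ℝ) {e : Fin 4 → C2}
    (he : ∀ i j, g (e i) (e j) = if i = j then 1 else 0) :
    frameMatrix e * gram (fun u v => g u v) * (frameMatrix e).transpose = 1 := by
  ext i j
  rw [Matrix.one_apply, ← he i j, bilin_eq_sum]
  simp only [Matrix.mul_apply, Matrix.transpose_apply, frameMatrix, gram, Matrix.of_apply,
    Finset.sum_mul, smul_eq_mul]
  rw [Finset.sum_comm]
  refine Finset.sum_congr rfl fun k _ => Finset.sum_congr rfl fun l _ => ?_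
  ring

/-- Orthonormality reads $EGE^{T}=1$, and one-sided inverses of square matrices are two-sided. -/
theorem gram_inv (g : C2 →ₗ[ℝ] C2 →ₗ[ℝ] ℝ) {e : Fin 4 → C2}
    (he : ∀ i j, g (e i) (e j) = if i = j then 1 else 0) :
    (gram (fun u v => g u v))⁻¹ = (frameMatrix e).transpose * frameMatrix e := by
  have h := frameMatrix_mul_gram g he
  refine Matrix.inv_eq_left_inv ?_
  rw [Matrix.mul_assoc]
  exact mul_eq_one_comm.1 h

theorem det_gram (g : C2 →ₗ[ℝ] C2 →ₗ[ℝ] ℝ) {e : Fin 4 → C2}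
    (he : ∀ i j, g (e i) (e j) = if i = j then 1 else 0) :
    (frameMatrix e).det ^ 2 * (gram (fun u v => g u v)).det = 1 := by
  have h := congrArg Matrix.det (frameMatrix_mul_gram g he)
  rw [Matrix.det_mul, Matrix.det_mul, Matrix.det_transpose, Matrix.det_one] at h
  linarith

theorem sum_six_comm {ι : Type*} [Fintype ι] (f : ι → ι → ι → ι → ι → ι → ℝ) :
    ∑ i, ∑ j, ∑ k, ∑ l, ∑ a, ∑ b, f i j k l a b =
      ∑ a, ∑ b, ∑ i, ∑ j, ∑ k, ∑ l, f i j k l a b := by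
  have move : ∀ h : ι → ι → ι → ι → ι → ℝ, ∑ i, ∑ j, ∑ k, ∑ l, ∑ a, h i j k l a =
      ∑ a, ∑ i, ∑ j, ∑ k, ∑ l, h i j k l a := by
    intro h
    conv_lhs => enter [2, i, 2, j, 2, k]; rw [Finset.sum_comm]
    conv_lhs => enter [2, i, 2, j]; rw [Finset.sum_comm]
    conv_lhs => enter [2, i]; rw [Finset.sum_comm]
    rw [Finset.sum_comm]
  rw [move]
  exact Finset.sum_congr rfl fun a _ => move _

/-- Substituting $G^{-1}=E^{T}E$ turns each contraction with the inverse metric into a sum over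
frame vectors, so no inverse matrix has to be computed. -/
theorem twoFormNormSq_eq_sum (g : C2 →ₗ[ℝ] C2 →ₗ[ℝ] ℝ) {e : Fin 4 → C2}
    (he : ∀ i j, g (e i) (e j) = if i = j then 1 else 0) (b : C2 →ₗ[ℝ] C2 →ₗ[ℝ] ℂ) :
    twoFormNormSq (fun u v => g u v) (fun u v => b u v) =
      (1 / 2) * ∑ i, ∑ j, Complex.normSq (b (e i) (e j)) := by
  rw [twoFormNormSq, gram_inv g he]
  congr 1
  have hR : ∀ i j, Complex.normSq (b (e i) (e j)) =
      ∑ p, ∑ q, ∑ k, ∑ l, frameMatrix e i p * frameMatrix e i k *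
        (frameMatrix e j q * frameMatrix e j l) *
        (b (realBasis p) (realBasis q) * conj (b (realBasis k) (realBasis l))).re := by
    intro i j
    have : Complex.normSq (b (e i) (e j)) = (b (e i) (e j) * conj (b (e i) (e j))).re := by
      rw [Complex.mul_conj, Complex.ofReal_re]
    rw [this, bilin_eq_sum]
    simp only [map_sum, Finset.sum_mul, Finset.mul_sum, Complex.re_sum]
    refine Finset.sum_congr rfl fun p _ => Finset.sum_congr rfl fun q _ =>
      Finset.sum_congr rfl fun k _ => Finset.sum_congr rfl fun l _ => ?_
    simp [frameMatrix]
    ring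
  simp only [hR]
  rw [← sum_six_comm]
  refine Finset.sum_congr rfl fun p _ => Finset.sum_congr rfl fun q _ =>
    Finset.sum_congr rfl fun k _ => Finset.sum_congr rfl fun l _ => ?_
  simp only [Matrix.mul_apply, Matrix.transpose_apply, Finset.sum_mul, Finset.mul_sum]
  exact Finset.sum_comm

/-- The Eguchi-Hanson metric as a bilinear map. -/
noncomputable def metricEHBilin (κ : ℝ) (z : C2) : C2 →ₗ[ℝ] C2 →ₗ[ℝ] ℝ :=
  LinearMap.mk₂ ℝ (metricEH κ z)
    (by intros; simp [metricEH, alpha, beta]; ring)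
    (by intros; simp [metricEH, alpha, beta]; ring)
    (by intros; simp [metricEH, alpha, beta]; ring)
    (by intros; simp [metricEH, alpha, beta]; ring)

theorem metricEHBilin_eq (κ : ℝ) (z : C2) :
    (fun u v => metricEHBilin κ z u v) = metricEH κ z := rfl

/-- The curvature as a bilinear map. -/
noncomputable def curvatureBilin (κ : ℝ) (hκ : 0 < κ) (z : C2) (hz : z ≠ 0) :
    C2 →ₗ[ℝ] C2 →ₗ[ℝ] ℂ :=
  LinearMap.mk₂ ℝ (extDerivOne (connA κ) z)
    (by
      intros
      simp only [extDerivOne_connA hκ hz]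
      rw [← mul_add, ← Complex.ofReal_add]
      congr 2
      simp [alpha, beta]
      ring)
    (by
      intros
      simp only [extDerivOne_connA hκ hz, Complex.real_smul]
      rw [mul_left_comm, ← Complex.ofReal_mul]
      congr 2
      simp [alpha, beta]
      ring)
    (by
      intros
      simp only [extDerivOne_connA hκ hz]
      rw [← mul_add, ← Complex.ofReal_add]
      congr 2
      simp [alpha, beta]
      ring)
    (by
      intros
      simp only [extDerivOne_connA hκ hz, Complex.real_smul]
      rw [mul_left_comm, ← Complex.ofReal_mul]
      congr 2
      simp [alpha, beta]
      ring)

theorem volDensity_metricEH (hκ : 0 < κ) (hz : z ≠ 0) : volDensity (metricEH κ z) = 1 := by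
  have h := det_gram (metricEHBilin κ z) (e := frameEH κ z) (metricEH_frameEH hκ hz)
  rw [frameMatrix, det_frameEH hκ hz, one_pow, one_mul, metricEHBilin_eq] at h
  rw [volDensity, h, Real.sqrt_one]

/-- Half of four nonzero frame entries, each of squared modulus $4\kappa/(s^2+\kappa)^2$. -/
theorem twoFormNormSq_curvature (hκ : 0 < κ) (hz : z ≠ 0) :
    twoFormNormSq (metricEH κ z) (extDerivOne (connA κ) z) =
      8 * κ / (radSq z ^ 2 + κ) ^ 2 := by
  have h := twoFormNormSq_eq_sum (metricEHBilin κ z) (e := frameEH κ z)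
    (metricEH_frameEH hκ hz) (curvatureBilin κ hκ z hz)
  refine h.trans ?_
  have hb : ∀ i j, curvatureBilin κ hκ z hz (frameEH κ z i) (frameEH κ z j) = _ :=
    fun i j => extDerivOne_connA_frameEH hκ hz i j
  simp only [hb, Fin.sum_univ_four, Complex.normSq_mul, Complex.normSq_ofReal,
    Complex.normSq_neg, Complex.normSq_I]
  have hk : √κ ^ 2 = κ := Real.sq_sqrt hκ.le
  have hpos : radSq z ^ 2 + κ ≠ 0 := by positivity
  simp
  field_simp
  rw [hk]
  ring

/-! ### Square integrability -/

/-- The norm on the product is the maximum norm, hence only an inequality. -/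
theorem norm_sq_le_radSq (z : C2) : ‖z‖ ^ 2 ≤ radSq z := by
  unfold radSq
  rcases max_choice ‖z.1‖ ‖z.2‖ with h | h <;> rw [Prod.norm_def, h] <;>
    nlinarith [sq_nonneg ‖z.1‖, sq_nonneg ‖z.2‖]

theorem integrable_curvature_density (hκ : 0 < κ) :
    MeasureTheory.Integrable (fun z : C2 => 8 * κ / (radSq z ^ 2 + κ) ^ 2)
      MeasureTheory.volume := by
  have hdim : (Module.finrank ℝ C2 : ℝ) < 8 := by simp; norm_num
  have : (MeasureTheory.volume : MeasureTheory.Measure C2).IsAddHaarMeasure := by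
    rw [MeasureTheory.Measure.volume_eq_prod]
    infer_instance
  -- The majorant is a multiple of $(1+\|z\|)^{-8}$, integrable as $8>4$. Its constant comes from
  -- squaring $(1+x)^4\le8(1+x^4)\le8(1+\kappa^{-1})(s^2+\kappa)$ with $x=\|z\|$.
  have hint := (integrable_one_add_norm (E := C2) (μ := MeasureTheory.volume) hdim).const_mul
    (8 * κ * (8 * (1 + κ⁻¹)) ^ 2)
  refine hint.mono' ?_ (Filter.Eventually.of_forall fun z => ?_)
  · have hc : Continuous radSq := contDiff_radSq.continuous
    refine (Continuous.div continuous_const (by fun_prop) fun z => ?_).aestronglyMeasurable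
    positivity
  · have hx := norm_nonneg z
    have hN : (1 + ‖z‖) ^ 4 ≤ 8 * (1 + κ⁻¹) * (radSq z ^ 2 + κ) := by
      have h1 : (1 + ‖z‖) ^ 4 ≤ 8 * (1 + ‖z‖ ^ 4) := by
        nlinarith [sq_nonneg (1 - ‖z‖), sq_nonneg (1 - ‖z‖ ^ 2), sq_nonneg (1 + ‖z‖),
          mul_nonneg (sq_nonneg (1 - ‖z‖)) (sq_nonneg (1 + ‖z‖)),
          mul_nonneg (sq_nonneg (1 - ‖z‖)) hx, mul_nonneg (sq_nonneg (1 - ‖z‖)) (sq_nonneg ‖z‖)]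
      have h2 : ‖z‖ ^ 4 ≤ radSq z ^ 2 := by
        have := pow_le_pow_left₀ (sq_nonneg ‖z‖) (norm_sq_le_radSq z) 2
        linarith [this, (by ring : (‖z‖ ^ 2) ^ 2 = ‖z‖ ^ 4)]
      have h3 : (1 + κ⁻¹) * (radSq z ^ 2 + κ) =
          1 + radSq z ^ 2 + (κ⁻¹ * radSq z ^ 2 + κ) := by field_simp; ring
      have h4 : 0 ≤ κ⁻¹ * radSq z ^ 2 + κ := by positivity
      nlinarith
    have hN2 := pow_le_pow_left₀ (by positivity) hN 2
    have hp : (1 + ‖z‖) ^ (-8 : ℝ) = ((1 + ‖z‖) ^ 8)⁻¹ := by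
      rw [Real.rpow_neg (by positivity)]
      norm_cast
    rw [Real.norm_of_nonneg (by positivity), hp, ← div_eq_mul_inv,
      div_le_div_iff₀ (by positivity) (by positivity)]
    calc 8 * κ * (1 + ‖z‖) ^ 8 = 8 * κ * ((1 + ‖z‖) ^ 4) ^ 2 := by ring
      _ ≤ 8 * κ * (8 * (1 + κ⁻¹) * (radSq z ^ 2 + κ)) ^ 2 := by gcongr
      _ = _ := by ring

theorem integrableOn_curvature (hκ : 0 < κ) :
    MeasureTheory.IntegrableOn
      (fun z : C2 => twoFormNormSq (metricEH κ z) (extDerivOne (connA κ) z) *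
        volDensity (metricEH κ z)) {z | z ≠ 0} MeasureTheory.volume := by
  refine (integrable_curvature_density hκ).integrableOn.congr_fun (fun z hz => ?_)
    (MeasurableSet.singleton (0 : C2)).compl
  simp only [twoFormNormSq_curvature hκ hz, volDensity_metricEH hκ hz, mul_one]

end EguchiHanson

theorem mainTheorem5 (κ : ℝ) (hκ : 0 < κ) :
    -- the circle action: generator, invariance of the flat structure, moment map equations
    (∀ p : C4, HasDerivAt (fun t : ℝ => circleAct (Circle.exp t) p) (generator p) 0) ∧
    (∀ (u : Circle) (X Y : C4),
      flatMetric (circleAct u X) (circleAct u Y) = flatMetric X Y ∧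
      omegaR (circleAct u X) (circleAct u Y) = omegaR X Y ∧
      omegaC (circleAct u X) (circleAct u Y) = omegaC X Y) ∧
    (Differentiable ℝ (moment κ) ∧ ∀ p X : C4,
      fderiv ℝ (muR κ) p X = -2 * omegaR (generator p) X ∧
      fderiv ℝ muC p X = Complex.I * omegaC (generator p) X) ∧
    -- the level set is cut out regularly, and `U(1)` acts freely on it
    (∀ p ∈ levelSet κ, Function.Surjective (fderiv ℝ (moment κ) p)) ∧
    (∀ p ∈ levelSet κ, ∀ u : Circle,
      circleAct u p ∈ levelSet κ ∧ (circleAct u p = p → u = 1)) ∧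
    -- the connection and the quotient metric are well defined on the circle bundle
    (∀ p ∈ levelSet κ, levelConnection p (generator p) = 1 ∧
      ∀ (u : Circle) (X Y : C4),
        levelConnection (circleAct u p) (circleAct u X) = levelConnection p X ∧
        quotientMetric (circleAct u p) (circleAct u X) (circleAct u Y) = quotientMetric p X Y) ∧
    -- the parametrisation of the level set
    ContDiffOn ℝ ∞ (param κ) {x | x.2 ≠ 0} ∧
    param κ '' {x | x.2 ≠ 0} = {p | p ∈ levelSet κ ∧ p.2 ≠ 0} ∧
    (∀ (ψ ψ' : ℝ) (z z' : C2), z ≠ 0 → z' ≠ 0 →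
      (param κ (ψ, z) = param κ (ψ', z') ↔
        (z' = z ∧ Complex.exp (Complex.I * ψ') = Complex.exp (Complex.I * ψ)) ∨
        (z' = -z ∧ Complex.exp (Complex.I * ψ') = -Complex.exp (Complex.I * ψ)))) ∧
    (∀ (t ψ : ℝ) (z : C2), param κ (ψ + t, z) = circleAct (Circle.exp t) (param κ (ψ, z))) ∧
    (∀ (ψ : ℝ) (z : C2), z ≠ 0 →
      Function.Injective (fderiv ℝ (param κ) (ψ, z)) ∧
      Set.range (fderiv ℝ (param κ) (ψ, z)) =
        {X | fderiv ℝ (moment κ) (param κ (ψ, z)) X = 0}) ∧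
    -- half the flat metric restricted to the level set
    (∀ (ψ : ℝ) (z : C2), z ≠ 0 → ∀ (τ τ' : ℝ) (v v' : C2),
      (((1 / 2) * flatMetric (fderiv ℝ (param κ) (ψ, z) (τ, v))
          (fderiv ℝ (param κ) (ψ, z) (τ', v')) : ℝ) : ℂ) =
        (metricHK κ z v v' : ℂ) + (radSq z * bigF κ z : ℝ) *
          ((τ + Complex.I * connA κ z v) * (τ' + Complex.I * connA κ z v'))) ∧
    (∀ z : C2, z ≠ 0 → ∀ v v' : C2, metricHK κ z v v' = metricEH κ z v v') ∧
    -- `dψ + i (A - Ā)` is the connection form of the level-set circle bundle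
    (∀ (ψ : ℝ) (z : C2), z ≠ 0 → ∀ (τ : ℝ) (v : C2),
      (levelConnection (param κ (ψ, z)) (fderiv ℝ (param κ) (ψ, z) (τ, v)) : ℂ) =
        τ + Complex.I * connA κ z v) ∧
    -- the quotient metric is the Eguchi-Hanson metric
    (∀ (ψ : ℝ) (z : C2), z ≠ 0 → ∀ (τ τ' : ℝ) (v v' : C2),
      quotientMetric (param κ (ψ, z)) (fderiv ℝ (param κ) (ψ, z) (τ, v))
        (fderiv ℝ (param κ) (ψ, z) (τ', v')) = metricEH κ z v v') ∧
    -- `z` modulo sign is a coordinate on an open dense subset of the quotient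
    (∃ j : {z : C2 // z ≠ 0} → HKQuotient κ,
      (∀ (z : {z : C2 // z ≠ 0}) (ψ : ℝ), ∃ hp : param κ (ψ, z.1) ∈ levelSet κ,
        j z = orbitOf κ (param κ (ψ, z.1)) hp) ∧
      Continuous j ∧ IsOpenMap j ∧ DenseRange j ∧
      (∀ (p : C4) (hp : p ∈ levelSet κ), orbitOf κ p hp ∈ Set.range j ↔ p.2 ≠ 0) ∧
      (∀ z z' : {z : C2 // z ≠ 0}, j z = j z' ↔ z'.1 = z.1 ∨ z'.1 = -z.1)) ∧
    -- the curvature of `A - Ā` is anti-self-dual and square integrable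
    (∀ v : C2, ContDiffOn ℝ ∞ (fun z => connA κ z v) {z | z ≠ 0}) ∧
    (∀ z : C2, z ≠ 0 → IsAntiSelfDual (metricEH κ z) (extDerivOne (connA κ) z)) ∧
    MeasureTheory.IntegrableOn
      (fun z : C2 => twoFormNormSq (metricEH κ z) (extDerivOne (connA κ) z) *
        volDensity (metricEH κ z)) {z | z ≠ 0} MeasureTheory.volume := by
  refine ⟨hasDerivAt_circleAct, fun u X Y => ⟨flatMetric_circleAct u X Y,
    omegaR_circleAct u X Y, omegaC_circleAct u X Y⟩, ⟨differentiable_moment κ,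
    fun p X => ⟨fderiv_muR κ p X, fderiv_muC p X⟩⟩, fun p hp => surjective_fderiv_moment hκ hp,
    fun p hp u => ⟨(moment_circleAct κ u p).trans hp, circleAct_free hκ hp⟩,
    fun p hp => ⟨levelConnection_generator hκ hp, fun u X Y =>
      ⟨levelConnection_circleAct u p X, quotientMetric_circleAct u p X Y⟩⟩,
    contDiffOn_param hκ, image_param hκ,
    fun ψ ψ' z z' hz _ => param_eq_param_iff hκ ψ ψ' hz, param_add κ,
    fun ψ z hz => ⟨injective_fderiv_param hκ hz ψ, range_fderiv_param hκ hz ψ⟩,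
    fun ψ z hz => ofReal_half_flatMetric_fderiv_param hκ hz ψ,
    fun z hz => metricHK_eq_metricEH κ hz, fun ψ z hz τ v => ?_,
    fun ψ z hz => quotientMetric_fderiv_param hκ hz ψ,
    ⟨toQuotient hκ, fun z ψ => ⟨param_mem_levelSet hκ z.2 ψ,
        (toQuotient_eq_orbitOf_iff hκ z _).2 ⟨ψ, rfl⟩⟩,
      continuous_toQuotient hκ, isOpenMap_toQuotient hκ, denseRange_toQuotient hκ,
      fun p hp => orbitOf_mem_range_iff hκ hp, toQuotient_eq_iff hκ⟩,
    contDiffOn_connA hκ, fun z hz => isAntiSelfDual_extDerivOne_connA hκ hz,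
    integrableOn_curvature hκ⟩
  rw [levelConnection_fderiv_param hκ hz, I_mul_connA, Complex.ofReal_add]
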